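/- Let $K$ be an algebraically closed field of characteristic $p>0$, let $q=p^n$ with $n\ge 1$, and let $r\ge 2$ be an integer. Let $\mathcal G_r\subset\mathbb P^2$ be the projective closure of the affine curve $y^{q^r+1}=x^q+x$ over $K$, and let $\hat{\mathcal G}_r$ be its smooth model (the nonsingular projective curve with the same function field). Then there exists a morphism $\xi:\hat{\mathcal G}_r\to\mathbb P^2$ such that $\xi$ is birational onto its image, the plane curve $\xi(\hat{\mathcal G}_r)$ has degree $q^r+1$, and $\xi(\hat{\mathcal G}_r)$ has two distinct outer Galois points. Here a point $P\in\mathbb P^2$ is a Galois point of an irreducible plane curve $C$ if the extension $K(C)/\pi_P^*K(\mathbb P^1)$ of function fields induced by the projection $\pi_P:C\dashrightarrow\mathbb P^1$ with centre $P$ is Galois, and it is outer if $P\notin C$. -/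

import Mathlib

open scoped LinearAlgebra.Projectivization

/-- An irreducible projective plane curve over `K` (used over algebraically closed `K`), given by an
irreducible homogeneous polynomial in the coordinates `X = X 0`, `Y = X 1`, `Z = X 2`. Over an
algebraically closed field the polynomial is determined by the set of points up to a constant. -/
structure PlaneCurve (K : Type*) [Field K] where
  /-- the defining form -/
  poly : MvPolynomial (Fin 3) K
  irreducible : Irreducible poly
  isHomogeneous : poly.IsHomogeneous poly.totalDegree

namespace PlaneCurve

variable {K : Type*} [Field K] (C : PlaneCurve K)

/-- The degree of a plane curve. -/
def degree : ℕ := C.poly.totalDegree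

/-- The points of a plane curve in the projective plane. Since the defining form is homogeneous,
the condition does not depend on the representative of the point. -/
def points : Set (ℙ K (Fin 3 → K)) := {P | MvPolynomial.eval P.rep C.poly = 0}

/-- The homogeneous coordinate ring `K[X, Y, Z] / (F)`. -/
abbrev CoordRing : Type _ := MvPolynomial (Fin 3) K ⧸ Ideal.span {C.poly}

instance instIsPrimeSpan : (Ideal.span {C.poly}).IsPrime :=
  (Ideal.span_singleton_prime C.irreducible.ne_zero).2 C.irreducible.prime

/-- The field of fractions of the homogeneous coordinate ring. -/
abbrev ConeField : Type _ := FractionRing C.CoordRing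

/-- The image of a polynomial in the field of fractions of the homogeneous coordinate ring. -/
noncomputable def cls (G : MvPolynomial (Fin 3) K) : C.ConeField :=
  algebraMap C.CoordRing C.ConeField (Ideal.Quotient.mk (Ideal.span {C.poly}) G)

/-- The function field `K(C)`: the quotients `G / H` of forms of the same degree, with `H` not
vanishing identically on `C`. -/
noncomputable def functionField : IntermediateField K C.ConeField :=
  IntermediateField.adjoin K
    {u | ∃ (d : ℕ) (G H : MvPolynomial (Fin 3) K), G.IsHomogeneous d ∧ H.IsHomogeneous d ∧
      C.cls H ≠ 0 ∧ u = C.cls G / C.cls H}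

/-- The pull-back to `K(C)` of the function field of the line parametrizing the lines through `P`,
under the projection of `C` with centre `P`: it is generated by the quotients `ℓ₁ / ℓ₂` of linear
forms vanishing at `P`, with `ℓ₂` not vanishing identically on `C`. -/
noncomputable def projectionField (P : ℙ K (Fin 3 → K)) : IntermediateField K C.functionField :=
  IntermediateField.adjoin K
    {u | ∃ ℓ₁ ℓ₂ : MvPolynomial (Fin 3) K, ℓ₁.IsHomogeneous 1 ∧ ℓ₂.IsHomogeneous 1 ∧
      MvPolynomial.eval P.rep ℓ₁ = 0 ∧ MvPolynomial.eval P.rep ℓ₂ = 0 ∧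
      C.cls ℓ₂ ≠ 0 ∧ (u : C.ConeField) = C.cls ℓ₁ / C.cls ℓ₂}

/-- `P` is a Galois point: the field extension induced by the projection from `P` is Galois. -/
def IsGaloisPoint (P : ℙ K (Fin 3 → K)) : Prop :=
  IsGalois (C.projectionField P) C.functionField

/-- An outer Galois point: a Galois point not lying on the curve. -/
def IsOuterGaloisPoint (P : ℙ K (Fin 3 → K)) : Prop :=
  P ∉ C.points ∧ C.IsGaloisPoint P

end PlaneCurve

/-- A place of a field extension `L / K`: a valuation ring `K ⊆ 𝒪 ⊊ L` of `L`. For a function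
field of one variable all these rings are discrete valuation rings. -/
structure Place (K L : Type*) [Field K] [Field L] [Algebra K L] where
  /-- the local ring of the place -/
  ring : ValuationSubring L
  algebraMap_mem : ∀ c : K, algebraMap K L c ∈ ring
  ne_top : ring ≠ ⊤

/-- `f` is regular at the place `P` and `f(P) = c`, that is, `f - c` lies in the maximal ideal. -/
def Place.HasValue {K L : Type*} [Field K] [Field L] [Algebra K L] (P : Place K L)
    (f : L) (c : K) : Prop :=
  f - algebraMap K L c ∈ P.ring.nonunits

namespace PlaneCurve

variable {K : Type*} [Field K] (C : PlaneCurve K)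

/-- The points of the smooth model of `C`, as the abstract nonsingular curve of the function field:
its points are the places of `K(C)`, and the local ring at a point is the ring of the place. -/
abbrev SmoothModel : Type _ := Place K C.functionField

/-- A morphism from the smooth model of `C` to the projective plane: a rational map
`(f₀ : f₁ : f₂)` which is regular at every point `P`, that is, for each `P` there is a rational
function `g` such that all `g fᵢ` are regular at `P` and do not all vanish at `P`; the value at `P`
is then `((g f₀)(P) : (g f₁)(P) : (g f₂)(P))`. -/
structure PlaneMorphism where
  /-- the map on points -/
  toFun : C.SmoothModel → ℙ K (Fin 3 → K)
  /-- homogeneous coordinates of the map as a rational map -/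
  coord : Fin 3 → C.functionField
  coord_ne_zero : coord ≠ 0
  regular : ∀ P : C.SmoothModel, ∃ (g : C.functionField) (v : Fin 3 → K) (hv : v ≠ 0),
    (∀ i, P.HasValue (g * coord i) (v i)) ∧ toFun P = Projectivization.mk K v hv

/-- The image of the morphism is the plane curve `D`, and the morphism is birational onto `D`:
the pull-back `G / H ↦ G(f₀, f₁, f₂) / H(f₀, f₁, f₂)` of rational functions is an isomorphism of
the function field of `D` onto that of `C`. -/
def PlaneMorphism.IsBirationalOnto {C : PlaneCurve K} (ξ : C.PlaneMorphism)
    (D : PlaneCurve K) : Prop :=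
  Set.range ξ.toFun = D.points ∧
  ∃ e : D.functionField ≃ₐ[K] C.functionField,
    ∀ (d : ℕ) (G H : MvPolynomial (Fin 3) K), G.IsHomogeneous d → H.IsHomogeneous d →
      D.cls H ≠ 0 → ∀ u : D.functionField, (u : D.ConeField) = D.cls G / D.cls H →
        e u = MvPolynomial.aeval ξ.coord G / MvPolynomial.aeval ξ.coord H

end PlaneCurve

/-- The homogenization `Y ^ (q ^ r + 1) - (X ^ q Z ^ (q ^ r + 1 - q) + X Z ^ (q ^ r))` of
`y ^ (q ^ r + 1) - (x ^ q + x)`. -/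
noncomputable def curveGPoly (K : Type*) [Field K] (q r : ℕ) : MvPolynomial (Fin 3) K :=
  MvPolynomial.X 1 ^ (q ^ r + 1) -
    (MvPolynomial.X 0 ^ q * MvPolynomial.X 2 ^ (q ^ r + 1 - q) +
      MvPolynomial.X 0 * MvPolynomial.X 2 ^ (q ^ r))

theorem curveGPoly_isHomogeneous (K : Type*) [Field K] (q r : ℕ) (hr : 2 ≤ r) :
    (curveGPoly K q r).IsHomogeneous (q ^ r + 1) := by
  have h1 : q ≤ q ^ r := Nat.le_self_pow (by omega) q
  have hX : ∀ (i : Fin 3) (k : ℕ), (MvPolynomial.X i ^ k : MvPolynomial (Fin 3) K).IsHomogeneous k :=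
    fun i k => MvPolynomial.isHomogeneous_X_pow i k
  refine (hX 1 _).sub (MvPolynomial.IsHomogeneous.add ?_ ?_)
  · have h := (hX 0 q).mul (hX 2 (q ^ r + 1 - q))
    rwa [show q + (q ^ r + 1 - q) = q ^ r + 1 by omega] at h
  · have h := (MvPolynomial.isHomogeneous_X K (0 : Fin 3)).mul (hX 2 (q ^ r))
    rwa [add_comm 1] at h

theorem curveGPoly_irreducible (K : Type*) [Field K] (q r : ℕ) (hq : 1 < q) (_hr : 2 ≤ r) :
    Irreducible (curveGPoly K q r) := by
  let e := (MvPolynomial.renameEquiv K (Equiv.swap (0 : Fin 3) 1)).trans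
    (MvPolynomial.finSuccEquiv K 2)
  set N := q ^ r + 1 with hN
  set a : MvPolynomial (Fin 2) K := MvPolynomial.X 0 ^ (q - 1) * MvPolynomial.X 1 ^ (N - q) +
    MvPolynomial.X 1 ^ (q ^ r) with ha
  have he : e (curveGPoly K q r) =
      Polynomial.X ^ N - Polynomial.C (MvPolynomial.X 0 * a) := by
    have h0 : e (MvPolynomial.X 0) = Polynomial.C (MvPolynomial.X 0) := by
      have := MvPolynomial.finSuccEquiv_X_succ (R := K) (n := 2) (j := 0)
      simpa [e] using this
    have h1 : e (MvPolynomial.X 1) = Polynomial.X := by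
      simp [e, MvPolynomial.finSuccEquiv_X_zero]
    have h2 : e (MvPolynomial.X 2) = Polynomial.C (MvPolynomial.X 1) := by
      have := MvPolynomial.finSuccEquiv_X_succ (R := K) (n := 2) (j := 1)
      have hs : (Equiv.swap (0 : Fin 3) 1) 2 = 2 := by decide
      simpa [e, hs] using this
    have hq' : q = (q - 1) + 1 := by omega
    have hx : (MvPolynomial.X 0 : MvPolynomial (Fin 2) K) * a =
        MvPolynomial.X 0 ^ q * MvPolynomial.X 1 ^ (N - q) +
          MvPolynomial.X 0 * MvPolynomial.X 1 ^ (q ^ r) := by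
      rw [ha, mul_add, ← mul_assoc, ← pow_succ', ← hq']
    rw [hx, curveGPoly]
    simp only [map_sub, map_add, map_mul, map_pow, h0, h1, h2, ← hN]
  rw [← MulEquiv.irreducible_iff e, he]
  have hp : Prime (MvPolynomial.X 0 : MvPolynomial (Fin 2) K) := MvPolynomial.X_prime
  have hna : ¬ (MvPolynomial.X 0 : MvPolynomial (Fin 2) K) ∣ a := by
    rintro ⟨t, ht⟩
    have := congrArg (MvPolynomial.eval ![(0 : K), 1]) ht
    have hq0 : q - 1 ≠ 0 := by omega
    simp [ha, hq0] at this
  have hN0 : N ≠ 0 := by omega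
  have hmon := Polynomial.monic_X_pow_sub_C (MvPolynomial.X 0 * a) hN0
  refine Polynomial.irreducible_of_eisenstein_criterion
    ((Ideal.span_singleton_prime hp.ne_zero).2 hp) ?_ ?_ ?_ ?_ hmon.isPrimitive
  · rw [hmon.leadingCoeff, Ideal.mem_span_singleton]
    exact fun h => hp.not_isUnit (isUnit_of_dvd_one h)
  · intro i hi
    rw [Polynomial.degree_X_pow_sub_C (by omega)] at hi
    have hi' : i ≠ N := by
      rintro rfl
      exact lt_irrefl _ hi
    rw [Ideal.mem_span_singleton, Polynomial.coeff_sub, Polynomial.coeff_X_pow, if_neg hi',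
      Polynomial.coeff_C]
    split_ifs
    · exact (dvd_sub_right (dvd_zero _)).2 (dvd_mul_right _ _)
    · simp
  · rw [Polynomial.degree_X_pow_sub_C (by omega)]
    exact_mod_cast Nat.pos_of_ne_zero hN0
  · rw [Polynomial.coeff_sub, Polynomial.coeff_X_pow, if_neg hN0.symm, Polynomial.coeff_C_zero,
      zero_sub, Ideal.span_singleton_pow, Ideal.mem_span_singleton, dvd_neg, pow_two]
    exact fun h => hna ((mul_dvd_mul_iff_left hp.ne_zero).1 h)

/-- The projective closure of the affine curve `y ^ (q ^ r + 1) = x ^ q + x`. -/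
noncomputable def curveG (K : Type*) [Field K] (q r : ℕ) (hq : 1 < q) (hr : 2 ≤ r) :
    PlaneCurve K where
  poly := curveGPoly K q r
  irreducible := curveGPoly_irreducible K q r hq hr
  isHomogeneous := by
    have h := curveGPoly_isHomogeneous K q r hr
    rwa [h.totalDegree (curveGPoly_irreducible K q r hq hr).ne_zero]

open Polynomial IntermediateField

/-! Put `N = q ^ r + 1`, which is `1` in `K`. The function field `L = K(x, y)` is a Kummer extension
of `K(x)`, because `y ^ N = x ^ q + x`. A second Kummer structure comes from a translation in `y`.
For suitable constants `a ≠ b` playing different roles, an additive polynomial `z` in `y` satisfies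
`z ^ q + z = b y ^ (q ^ r) + b ^ (q ^ r) y`, and these are exactly the cross terms of `(y + b) ^ N`.
Hence `(y + b) ^ N = (x + z + a) ^ q + (x + z + a)` (`add_pow_eq_of_pow_eq`), and `L` is also Galois
over `K(x + z)`.

The morphism is `(x : z : 1)`. Projection from `(0 : 1 : 0)` is `x` and projection from `(1 : -1 :
0)` is `x + z`, so both centres are Galois points once the map is birational, that is, once `y ∈
K(x, z)`. An automorphism over `K(x, z)` multiplies `y` and `y + b` by constants; as `y` is not
constant and `b ≠ 0`, it fixes `y` (`mem_of_pow_mem_of_add_pow_mem`).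

For the degree, work on the cone with `w` the class of the third coordinate. Both `w y` and `w z`
are integral over `K[w x, w]` and generate the same field, so their minimal polynomials have the
same degree. That of `w z` is a form, hence an equation of the image, of degree `N`
(`exists_planeCurve_of_coord`).

The centres are outer because poles of `x` are all sent to `(1 : 0 : 0)` and every other place to a
point off the line `Z = 0` (`Place.exists_hasValue_coord`). That the image is the whole plane curve
follows by extending specializations to valuation rings (`PlaneMorphism.range_eq_points`). -/

/-! ### Kummer extensions with constant roots of unity -/

theorem exists_eq_algebraMap_mul_of_pow_eq {K L : Type*} [Field K] [IsAlgClosed K] [Field L]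
    [Algebra K L] {N : ℕ} (hN : (N : K) ≠ 0) {s t : L} (h : s ^ N = t ^ N) :
    ∃ w : K, w ^ N = 1 ∧ s = algebraMap K L w * t := by
  have hN0 : N ≠ 0 := by rintro rfl; simp at hN
  have : NeZero N := ⟨hN0⟩
  have : NeZero (N : K) := ⟨hN⟩
  by_cases ht : t = 0
  · refine ⟨1, one_pow _, ?_⟩
    subst ht
    rw [zero_pow hN0] at h
    simp [pow_eq_zero_iff hN0 |>.1 h]
  obtain ⟨μ, hμ⟩ := HasEnoughRootsOfUnity.exists_primitiveRoot K N
  have hμ' : IsPrimitiveRoot (algebraMap K L μ) N := hμ.map_of_injective (algebraMap K L).injective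
  obtain ⟨i, -, hi⟩ := hμ'.eq_pow_of_pow_eq_one (ξ := s / t) (by
    rw [div_pow, h, div_self (pow_ne_zero _ ht)])
  refine ⟨μ ^ i, by rw [← pow_mul, mul_comm, pow_mul, hμ.pow_eq_one, one_pow], ?_⟩
  rw [map_pow, hi, div_mul_cancel₀ _ ht]

/-- `L` is the splitting field over `K(x)` of `X ^ N - y ^ N`, which is separable since `N` and `y`
are nonzero. Irreducibility of this polynomial is not needed. -/
theorem isGalois_adjoin_simple_of_pow_mem {K L : Type*} [Field K] [IsAlgClosed K] [Field L]
    [Algebra K L] {N : ℕ} (hN : (N : K) ≠ 0) {x y : L} (hy : y ≠ 0) (hxy : y ^ N ∈ K⟮x⟯)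
    (htop : K⟮x, y⟯ = ⊤) : IsGalois K⟮x⟯ L := by
  have hN0 : N ≠ 0 := by rintro rfl; simp at hN
  have : NeZero N := ⟨hN0⟩
  have : NeZero (N : K) := ⟨hN⟩
  obtain ⟨μ, hμ⟩ := HasEnoughRootsOfUnity.exists_primitiveRoot K N
  have hμ' : IsPrimitiveRoot (algebraMap K⟮x⟯ L (algebraMap K K⟮x⟯ μ)) N :=
    (hμ.map_of_injective (algebraMap K K⟮x⟯).injective).map_of_injective
      (algebraMap K⟮x⟯ L).injective
  have hμ0 : IsPrimitiveRoot (algebraMap K⟮x⟯ L (algebraMap K K⟮x⟯ μ)) N := hμ'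
  set c : K⟮x⟯ := ⟨y ^ N, hxy⟩ with hc
  have hyc : y ^ N = algebraMap K⟮x⟯ L c := rfl
  have hc0 : c ≠ 0 := by
    intro h
    rw [h, map_zero] at hyc
    exact hy (pow_eq_zero_iff hN0 |>.1 hyc)
  have hNx : (N : K⟮x⟯) ≠ 0 := by
    have := (map_ne_zero (algebraMap K K⟮x⟯)).2 hN
    rwa [map_natCast] at this
  have hroot : y ∈ (X ^ N - C c : K⟮x⟯[X]).rootSet L := by
    rw [mem_rootSet]
    exact ⟨X_pow_sub_C_ne_zero (Nat.pos_of_ne_zero hN0) _, by simp [hyc]⟩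
  have hsplit : ((X ^ N - C c : K⟮x⟯[X]).map (algebraMap K⟮x⟯ L)).Splits := by
    rw [Polynomial.map_sub, Polynomial.map_pow, map_X, map_C]
    exact X_pow_sub_C_splits_of_isPrimitiveRoot hμ0 hyc
  have : IsSplittingField K⟮x⟯ L (X ^ N - C c : K⟮x⟯[X]) := by
    refine (isSplittingField_iff_intermediateField).2 ⟨hsplit, ?_⟩
    have h1 : adjoin K⟮x⟯ {y} = ⊤ := by
      rw [← restrictScalars_eq_top_iff (K := K), adjoin_simple_adjoin_simple, htop]
    refine top_unique (h1.symm.le.trans (adjoin.mono _ _ _ ?_))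
    simpa using hroot
  exact IsGalois.of_separable_splitting_field (p := (X ^ N - C c : K⟮x⟯[X]))
    (separable_X_pow_sub_C c hNx hc0)

/-- If `L = K(x, y)` where `y ^ N` lies in `K(x)` and `(y + b) ^ N` lies in `K(x, z)`, then
`L = K(x, z)`. -/
theorem mem_of_pow_mem_of_add_pow_mem {K L : Type*} [Field K] [IsAlgClosed K] [Field L]
    [Algebra K L] {N : ℕ} (hN : (N : K) ≠ 0) {x y : L} (hy : y ∉ (algebraMap K L).range)
    (hxy : y ^ N ∈ K⟮x⟯) (htop : K⟮x, y⟯ = ⊤) {b : K} (hb : b ≠ 0) (M : IntermediateField K L)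
    (hxM : x ∈ M) (hbM : (y + algebraMap K L b) ^ N ∈ M) : y ∈ M := by
  have hy0 : y ≠ 0 := by
    rintro rfl
    exact hy (zero_mem _)
  have hle : K⟮x⟯ ≤ M := by simpa using hxM
  have := isGalois_adjoin_simple_of_pow_mem hN hy0 hxy htop
  have : IsGalois (extendScalars hle) L := inferInstance
  have hyM : y ^ N ∈ M := hle hxy
  have key : y ∈ (⊥ : IntermediateField (extendScalars hle) L) := by
    rw [InfiniteGalois.mem_bot_iff_fixed]
    intro σ
    have hfix : ∀ t ∈ M, σ t = t := fun t ht => σ.commutes ⟨t, ht⟩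
    have hK : ∀ k : K, σ (algebraMap K L k) = algebraMap K L k :=
      fun k => hfix _ (M.algebraMap_mem k)
    -- From `σ y = w y` and `σ (y + b) = v (y + b)` one gets `(w - v) y = (v - 1) b`. Since `y` is
    -- not constant, `w = v`, and then `b ≠ 0` forces `v = 1`.
    obtain ⟨w, hw, hw'⟩ := exists_eq_algebraMap_mul_of_pow_eq hN (s := σ y) (t := y)
      (by rw [← map_pow, hfix _ hyM])
    obtain ⟨v, hv, hv'⟩ := exists_eq_algebraMap_mul_of_pow_eq hN
      (s := σ (y + algebraMap K L b)) (t := y + algebraMap K L b)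
      (by rw [← map_pow, hfix _ hbM])
    rw [map_add, hK, hw'] at hv'
    have hlin : algebraMap K L (w - v) * y = algebraMap K L ((v - 1) * b) := by
      simp only [map_sub, map_mul, map_one]
      linear_combination hv'
    have hwv : w - v = 0 := by
      by_contra hne
      apply hy
      refine ⟨(w - v)⁻¹ * ((v - 1) * b), ?_⟩
      rw [map_mul, ← hlin, ← mul_assoc, ← map_mul, inv_mul_cancel₀ hne, map_one, one_mul]
    rw [hwv, map_zero, zero_mul, eq_comm, map_eq_zero, mul_eq_zero, or_iff_left hb] at hlin
    rw [hw', sub_eq_zero.1 hwv, sub_eq_zero.1 hlin, map_one, one_mul]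
  obtain ⟨t, ht⟩ := mem_bot.1 key
  rw [← ht]
  exact t.2

/-! ### The additive polynomial and the translation `y ↦ y + b` -/

/-- The additive polynomial `∑ i < r, (-1) ^ i b ^ (q ^ (r + i)) t ^ (q ^ i)`. -/
def additivePoly {K L : Type*} [Field K] [Field L] [Algebra K L] (q r : ℕ) (b : K) (t : L) : L :=
  ∑ i ∈ Finset.range r, algebraMap K L ((-1) ^ i * b ^ q ^ (r + i)) * t ^ q ^ i

/-- The sum telescopes: raising the `i`-th term to the power `q` gives minus the next term, so only
the term of index `0` and minus the term of index `r` remain. The condition on `b` makes the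
coefficient of the latter equal to `b`. -/
theorem additivePoly_pow_add {K L : Type*} [Field K] [Field L] [Algebra K L] (p : ℕ)
    [Fact p.Prime] [CharP K p] {n q r : ℕ} (hq : q = p ^ n) (hr : 0 < r) {b : K}
    (hb : b ^ q ^ (2 * r) = (-1) ^ (r - 1) * b) (t : L) :
    additivePoly q r b t ^ q + additivePoly q r b t =
      algebraMap K L b * t ^ q ^ r + algebraMap K L (b ^ q ^ r) * t := by
  have : CharP L p := charP_of_injective_algebraMap (algebraMap K L).injective p
  have : ExpChar L p := ExpChar.prime Fact.out
  have hm1 : (-1 : K) ^ q = -1 := by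
    have : ExpChar K p := ExpChar.prime Fact.out
    subst hq
    have h := map_neg (iterateFrobenius K p n) 1
    simpa [iterateFrobenius_def] using h
  set g : ℕ → L := fun i => algebraMap K L ((-1) ^ i * b ^ q ^ (r + i)) * t ^ q ^ i with hg
  have hstep : ∀ i, g i ^ q = - g (i + 1) := by
    intro i
    simp only [hg]
    have h1 : ((-1 : K) ^ i) ^ q = (-1) ^ i := by rw [← pow_mul, mul_comm, pow_mul, hm1]
    rw [mul_pow, ← map_pow, mul_pow, h1, ← pow_mul, ← pow_mul, ← pow_succ, ← pow_succ,
      ← add_assoc, pow_succ (-1 : K)]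
    simp
  have hpow : additivePoly q r b t ^ q = ∑ i ∈ Finset.range r, g i ^ q := by
    subst hq
    exact sum_pow_char_pow p n _ _
  have htel : additivePoly q r b t ^ q + additivePoly q r b t = g 0 - g r := by
    rw [hpow, show additivePoly q r b t = ∑ i ∈ Finset.range r, g i from rfl,
      ← Finset.sum_add_distrib, ← Finset.sum_range_sub' g r]
    refine Finset.sum_congr rfl fun i _ => ?_
    rw [hstep]
    ring
  rw [htel]
  obtain ⟨k, rfl⟩ : ∃ k, r = k + 1 := ⟨r - 1, by omega⟩
  have hc : (-1 : K) ^ (k + 1) * b ^ q ^ (k + 1 + (k + 1)) = - b := by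
    rw [← two_mul, hb, Nat.add_sub_cancel, ← mul_assoc, ← pow_add]
    rw [show k + 1 + k = 2 * k + 1 by ring, pow_succ, pow_mul]
    simp
  simp only [hg, hc]
  simp
  ring

theorem exists_pow_eq_neg_one_pow_mul (K : Type*) [Field K] [IsAlgClosed K] (k m : ℕ) (hk : 1 < k) :
    ∃ b : K, b ≠ 0 ∧ b ^ k = (-1) ^ m * b := by
  obtain ⟨b, hb⟩ := IsAlgClosed.exists_pow_nat_eq ((-1 : K) ^ m) (n := k - 1) (by omega)
  refine ⟨b, ?_, ?_⟩
  · rintro rfl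
    rw [zero_pow (by omega)] at hb
    exact pow_ne_zero m (by simp) hb.symm
  · rw [← hb, ← pow_succ]
    congr 1
    omega

theorem exists_pow_add_self_eq {K : Type*} [Field K] [IsAlgClosed K] {q : ℕ} (hq : 1 < q) (c : K) :
    ∃ a : K, a ^ q + a = c := by
  have hd : (X ^ q + X - C c : K[X]).degree ≠ 0 := by
    have : (X ^ q + X - C c : K[X]).degree = q := by
      rw [add_sub_assoc]
      have h2 : (X - C c : K[X]).degree < (X ^ q : K[X]).degree := by
        rw [degree_X_sub_C, degree_X_pow]
        exact_mod_cast hq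
      rw [degree_add_eq_left_of_degree_lt h2, degree_X_pow]
    rw [this]
    exact_mod_cast (by omega : q ≠ 0)
  obtain ⟨a, ha⟩ := IsAlgClosed.exists_root _ hd
  refine ⟨a, ?_⟩
  simpa [sub_eq_zero] using ha

/-- Expand the left side as `(y ^ (q ^ r) + b ^ (q ^ r)) (y + b)`. The pure terms are accounted for
by `x` and `a`, the cross terms by `additivePoly_pow_add`. -/
theorem add_pow_eq_of_pow_eq {K L : Type*} [Field K] [Field L] [Algebra K L] (p : ℕ)
    [Fact p.Prime] [CharP K p] {n q r : ℕ} (hq : q = p ^ n) (hr : 0 < r) {a b : K}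
    (hb : b ^ q ^ (2 * r) = (-1) ^ (r - 1) * b) (ha : a ^ q + a = b ^ (q ^ r + 1)) {x y : L}
    (h : y ^ (q ^ r + 1) = x ^ q + x) :
    (y + algebraMap K L b) ^ (q ^ r + 1) =
      (x + additivePoly q r b y + algebraMap K L a) ^ q +
        (x + additivePoly q r b y + algebraMap K L a) := by
  have : CharP L p := charP_of_injective_algebraMap (algebraMap K L).injective p
  have hf := additivePoly_pow_add p hq hr hb y
  have hadd : ∀ m : ℕ, ∀ s t : L, (s + t) ^ q ^ m = s ^ q ^ m + t ^ q ^ m := by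
    intro m s t
    rw [hq, ← pow_mul]
    exact add_pow_char_pow _ _ _ _
  have hadd1 : ∀ s t : L, (s + t) ^ q = s ^ q + t ^ q := by simpa using hadd 1
  have ha' := congrArg (algebraMap K L) ha
  simp only [map_add, map_pow] at ha' hf
  rw [pow_succ, hadd, hadd1, hadd1]
  linear_combination h - hf - ha'

theorem additivePoly_mem {K L : Type*} [Field K] [Field L] [Algebra K L] (q r : ℕ) (b : K) {t : L}
    {M : IntermediateField K L} (ht : t ∈ M) : additivePoly q r b t ∈ M :=
  sum_mem fun _ _ => mul_mem (M.algebraMap_mem _) (pow_mem ht _)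

/-! ### Scaling of forms, and valuation rings over a specialization -/

theorem MvPolynomial.IsHomogeneous.aeval_const_mul {R S : Type*} {σ : Type*} [Fintype σ]
    [CommRing R] [CommRing S] [Algebra R S] {G : MvPolynomial σ R} {d : ℕ} (hG : G.IsHomogeneous d)
    (c : S) (f : σ → S) :
    MvPolynomial.aeval (fun i => c * f i) G = c ^ d * MvPolynomial.aeval f G := by
  rw [MvPolynomial.aeval_def, MvPolynomial.aeval_def, MvPolynomial.eval₂_eq',
    MvPolynomial.eval₂_eq', Finset.mul_sum]
  refine Finset.sum_congr rfl fun m hm => ?_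
  have hd : ∑ i, m i = d := by
    rw [← hG (MvPolynomial.mem_support_iff.1 hm), Finsupp.weight_apply, Finsupp.sum_fintype]
    · simp
    · simp
  simp only [mul_pow, Finset.prod_mul_distrib, Finset.prod_pow_eq_pow_sum, hd]
  ring

/-- Extension of a specialization: `φ` descends to the image of `g`; localize that image at the
kernel and take a valuation ring of `L` dominating the local ring. -/
theorem exists_valuationSubring_of_ker_le {K A L : Type*} [Field K] [Field L] [Algebra K L]
    [CommRing A] [Algebra K A] (g : A →ₐ[K] L) (φ : A →ₐ[K] K)
    (h : ∀ a, g a = 0 → φ a = 0) :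
    ∃ O : ValuationSubring L, (∀ a, g a ∈ O) ∧
      ∀ a, g a - algebraMap K L (φ a) ∈ O.nonunits := by
  have hs : Function.Surjective g.rangeRestrict := g.rangeRestrict_surjective
  have hk : RingHom.ker g.rangeRestrict ≤ RingHom.ker φ := fun a ha => by
    rw [RingHom.mem_ker] at ha ⊢
    exact h a (congrArg Subtype.val ha)
  let ψ : g.range →ₐ[K] K := AlgHom.liftOfSurjective g.rangeRestrict hs φ hk
  have hψ : ∀ a, ψ (g.rangeRestrict a) = φ a := AlgHom.liftOfSurjective_apply _ hs φ hk
  let R : Subring L := g.range.toSubring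
  let ψ' : R →+* K := ψ.toRingHom
  let P : Ideal R := RingHom.ker ψ'
  have hP : P.IsPrime := RingHom.ker_isPrime ψ'
  obtain ⟨O, hO, hloc⟩ := (LocalSubring.ofPrime R P).exists_le_valuationSubring
  have hmem : ∀ a, g a ∈ O := fun a => hO (LocalSubring.le_ofPrime R P ⟨a, rfl⟩)
  refine ⟨O, hmem, fun a => ?_⟩
  set t : R := ⟨g (a - algebraMap K A (φ a)), ⟨_, rfl⟩⟩ with ht
  have htP : t ∈ P := by
    have : ψ' t = φ (a - algebraMap K A (φ a)) := hψ _
    rw [RingHom.mem_ker, this, map_sub, AlgHom.commutes, Algebra.algebraMap_self_apply, sub_self]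
  have ht1 : algebraMap R (LocalSubring.ofPrime R P).toSubring t ∈
      IsLocalRing.maximalIdeal (LocalSubring.ofPrime R P).toSubring :=
    (IsLocalization.AtPrime.to_map_mem_maximal_iff _ P t).2 htP
  have ht2 : Subring.inclusion hO (algebraMap R (LocalSubring.ofPrime R P).toSubring t) ∈
      nonunits O.toSubring := by
    intro hu
    exact (IsLocalRing.mem_maximalIdeal _).1 ht1 (hloc.map_nonunit _ hu)
  have heq : g a - algebraMap K L (φ a) = (t : L) := by simp [ht]
  rw [heq, ValuationSubring.mem_nonunits_iff_exists_mem_maximalIdeal]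
  exact ⟨hmem _, ht2⟩

/-! ### Values of functions at a place -/

namespace Place

variable {K L : Type*} [Field K] [Field L] [Algebra K L] (P : Place K L)

theorem hasValue_iff {f : L} {c : K} :
    P.HasValue f c ↔ P.ring.valuation (f - algebraMap K L c) < 1 :=
  P.ring.mem_nonunits_iff

theorem valuation_algebraMap_le (c : K) : P.ring.valuation (algebraMap K L c) ≤ 1 :=
  (P.ring.valuation_le_one_iff _).2 (P.algebraMap_mem c)

theorem valuation_algebraMap {c : K} (hc : c ≠ 0) : P.ring.valuation (algebraMap K L c) = 1 := by
  refine le_antisymm (P.valuation_algebraMap_le c) ?_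
  have h := mul_le_mul_right (P.valuation_algebraMap_le c⁻¹) (P.ring.valuation (algebraMap K L c))
  rwa [← map_mul, ← map_mul, mul_inv_cancel₀ hc, map_one, map_one, mul_one] at h

variable {P}

theorem HasValue.eq_zero {c : K} (h : P.HasValue 0 c) : c = 0 := by
  by_contra hc
  rw [hasValue_iff, zero_sub, Valuation.map_neg, P.valuation_algebraMap hc] at h
  exact lt_irrefl _ h

theorem hasValue_algebraMap (c : K) : P.HasValue (algebraMap K L c) c := by
  simp [hasValue_iff]

theorem HasValue.valuation_le {f : L} {c : K} (h : P.HasValue f c) : P.ring.valuation f ≤ 1 := by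
  have := P.ring.valuation.map_add_le (P.hasValue_iff.1 h).le (P.valuation_algebraMap_le c)
  rwa [sub_add_cancel] at this

theorem HasValue.add {f g : L} {c d : K} (hf : P.HasValue f c) (hg : P.HasValue g d) :
    P.HasValue (f + g) (c + d) := by
  rw [hasValue_iff, map_add, add_sub_add_comm]
  exact P.ring.valuation.map_add_lt (P.hasValue_iff.1 hf) (P.hasValue_iff.1 hg)

theorem HasValue.mul {f g : L} {c d : K} (hf : P.HasValue f c) (hg : P.HasValue g d) :
    P.HasValue (f * g) (c * d) := by
  rw [hasValue_iff, map_mul, show f * g - algebraMap K L c * algebraMap K L d =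
    (f - algebraMap K L c) * g + algebraMap K L c * (g - algebraMap K L d) by ring]
  refine P.ring.valuation.map_add_lt ?_ ?_
  · rw [map_mul]
    exact (mul_le_of_le_one_right zero_le hg.valuation_le).trans_lt (P.hasValue_iff.1 hf)
  · rw [map_mul]
    exact (mul_le_of_le_one_left zero_le (P.valuation_algebraMap_le c)).trans_lt
      (P.hasValue_iff.1 hg)

theorem HasValue.neg {f : L} {c : K} (hf : P.HasValue f c) : P.HasValue (-f) (-c) := by
  rw [hasValue_iff] at hf ⊢
  rwa [map_neg, ← neg_sub', Valuation.map_neg]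

theorem HasValue.sub {f g : L} {c d : K} (hf : P.HasValue f c) (hg : P.HasValue g d) :
    P.HasValue (f - g) (c - d) := by
  rw [sub_eq_add_neg, sub_eq_add_neg]
  exact hf.add hg.neg

theorem HasValue.pow {f : L} {c : K} (hf : P.HasValue f c) (n : ℕ) :
    P.HasValue (f ^ n) (c ^ n) := by
  induction n with
  | zero => simpa using P.hasValue_algebraMap 1
  | succ n ih => rw [pow_succ, pow_succ]; exact ih.mul hf

theorem HasValue.sum {ι : Type*} {s : Finset ι} {f : ι → L} {c : ι → K}
    (h : ∀ i ∈ s, P.HasValue (f i) (c i)) : P.HasValue (∑ i ∈ s, f i) (∑ i ∈ s, c i) := by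
  classical
  induction s using Finset.induction_on with
  | empty => simpa using P.hasValue_algebraMap 0
  | insert a s ha ih =>
    rw [Finset.sum_insert ha, Finset.sum_insert ha]
    exact (h a (Finset.mem_insert_self _ _)).add
      (ih fun i hi => h i (Finset.mem_insert_of_mem hi))

theorem HasValue.mvPolynomial_aeval {σ : Type*} {f : σ → L} {v : σ → K}
    (h : ∀ i, P.HasValue (f i) (v i)) (G : MvPolynomial σ K) :
    P.HasValue (MvPolynomial.aeval f G) (MvPolynomial.eval v G) := by
  induction G using MvPolynomial.induction_on with
  | C a => simpa using P.hasValue_algebraMap a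
  | add p q hp hq => simpa using hp.add hq
  | mul_X p i hp => simpa using hp.mul (h i)

/-- Over `K` the polynomial splits into factors `X - c`. If no `f - c` were in the maximal ideal,
each factor, hence the product, would have valuation at least `1`. -/
theorem exists_hasValue_of_aeval [IsAlgClosed K] {p : K[X]} (hp : p ≠ 0) {f : L}
    (h : P.ring.valuation (aeval f p) < 1) : ∃ c, P.HasValue f c := by
  by_contra! hne
  have hs := IsAlgClosed.splits p
  rw [hs.eq_prod_roots, map_mul, aeval_C, map_mul,
    P.valuation_algebraMap (leadingCoeff_ne_zero.2 hp), one_mul] at h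
  refine h.not_ge ?_
  have hall : ∀ s : Multiset K,
      1 ≤ P.ring.valuation (aeval f (s.map fun a => X - C a).prod) := by
    intro s
    induction s using Multiset.induction_on with
    | empty => simp
    | cons a s ih =>
      rw [Multiset.map_cons, Multiset.prod_cons, map_mul, map_mul]
      refine one_le_mul ?_ ih
      have := hne a
      rw [hasValue_iff, not_lt] at this
      simpa using this
  exact hall _

/-- If a regular `f` had no value in `K`, every nonzero polynomial in `f` would be a unit of the
place, so `K(f)` would lie in its ring. As `L` is algebraic over `K(f)` and valuation rings are
integrally closed, the ring would be all of `L`. -/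
theorem exists_hasValue_of_mem [IsAlgClosed K] {f : L} [Algebra.IsAlgebraic K⟮f⟯ L]
    (hf : f ∈ P.ring) : ∃ c, P.HasValue f c := by
  by_contra hne
  have hpoly : ∀ p : K[X], aeval f p ∈ P.ring := fun p => by
    induction p using Polynomial.induction_on' with
    | add p q hp hq => rw [map_add]; exact add_mem hp hq
    | monomial n a =>
      rw [aeval_monomial]
      exact mul_mem (P.algebraMap_mem a) (pow_mem hf n)
  have hle : ∀ t ∈ K⟮f⟯, t ∈ P.ring := by
    intro t ht
    obtain ⟨a, b, rfl⟩ := (mem_adjoin_simple_iff K t).1 ht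
    by_cases hb : b = 0
    · simp [hb]
    have hb1 : 1 ≤ P.ring.valuation (aeval f b) := by
      by_contra hlt
      exact hne (exists_hasValue_of_aeval hb (not_le.1 hlt))
    rw [← ValuationSubring.valuation_le_one_iff, map_div₀]
    exact div_le_one_of_le₀ (((P.ring.valuation_le_one_iff _).2 (hpoly a)).trans hb1) zero_le
  apply P.ne_top
  rw [eq_top_iff]
  intro t _
  let φ : K⟮f⟯ →+* P.ring :=
    (K⟮f⟯.toSubring.subtype).codRestrict P.ring.toSubring fun s => hle _ s.2
  have hint : IsIntegral P.ring t := by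
    obtain ⟨m, hm, hmt⟩ := Algebra.IsIntegral.isIntegral (R := K⟮f⟯) t
    refine ⟨m.map φ, hm.map φ, ?_⟩
    rw [eval₂_map]
    exact hmt
  obtain ⟨s, hs⟩ := IsIntegrallyClosed.isIntegral_iff.1 hint
  rw [← hs]
  exact s.2

end Place

/-! ### Morphisms from the smooth model and their images -/

namespace PlaneCurve

variable {K : Type*} [Field K]

theorem _root_.MvPolynomial.IsHomogeneous.eval_rep_mk_eq_zero_iff {G : MvPolynomial (Fin 3) K}
    {d : ℕ} (hG : G.IsHomogeneous d) (v : Fin 3 → K) (hv : v ≠ 0) :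
    MvPolynomial.eval (Projectivization.mk K v hv).rep G = 0 ↔ MvPolynomial.eval v G = 0 := by
  obtain ⟨a, ha⟩ := Projectivization.exists_smul_eq_mk_rep K v hv
  have h := hG.aeval_const_mul (a : K) v
  have h2 : (fun i => (a : K) * v i) = (Projectivization.mk K v hv).rep := by
    rw [← ha]; rfl
  rw [h2] at h
  simp only [MvPolynomial.aeval_eq_eval] at h
  rw [h, mul_eq_zero, or_iff_right (pow_ne_zero _ a.ne_zero)]

theorem mk_mem_points_iff (C : PlaneCurve K) (v : Fin 3 → K) (hv : v ≠ 0) :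
    Projectivization.mk K v hv ∈ C.points ↔ MvPolynomial.eval v C.poly = 0 :=
  C.isHomogeneous.eval_rep_mk_eq_zero_iff v hv

variable {C : PlaneCurve K}

/-- A morphism from the smooth model, from its coordinates. -/
noncomputable def PlaneMorphism.ofCoord (f : Fin 3 → C.functionField) (hf : f ≠ 0)
    (h : ∀ P : C.SmoothModel, ∃ (g : C.functionField) (v : Fin 3 → K), v ≠ 0 ∧
      ∀ i, P.HasValue (g * f i) (v i)) : C.PlaneMorphism where
  toFun P := Projectivization.mk K (h P).choose_spec.choose (h P).choose_spec.choose_spec.1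
  coord := f
  coord_ne_zero := hf
  regular P := ⟨(h P).choose, _, _, (h P).choose_spec.choose_spec.2, rfl⟩

/-- The value does not depend on the multiplier: the 2 by 2 minors of two normalized coordinate
vectors vanish identically, so the minors of their values are zero. -/
theorem PlaneMorphism.toFun_eq (ξ : C.PlaneMorphism) (P : C.SmoothModel) (g : C.functionField)
    (v : Fin 3 → K) (hv : v ≠ 0) (h : ∀ i, P.HasValue (g * ξ.coord i) (v i)) :
    ξ.toFun P = Projectivization.mk K v hv := by
  obtain ⟨g', v', hv', h', heq⟩ := ξ.regular P
  rw [heq, Projectivization.mk_eq_mk_iff']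
  obtain ⟨i, hi⟩ := Function.ne_iff.1 hv
  have hi : v i ≠ 0 := hi
  refine ⟨v' i / v i, funext fun j => ?_⟩
  have h1 : P.HasValue 0 (v' i * v j - v' j * v i) := by
    have := ((h' i).mul (h j)).sub ((h' j).mul (h i))
    rwa [show g' * ξ.coord i * (g * ξ.coord j) - g' * ξ.coord j * (g * ξ.coord i) = 0 by ring]
      at this
  have h2 := h1.eq_zero
  rw [Pi.smul_apply, smul_eq_mul]
  field_simp
  linear_combination h2

/-- Values satisfy the equation of `D` because the coordinates do. Conversely, a point of `D` with
nonzero `i`-th coordinate specializes the ratios of the coordinates to the `i`-th, and any place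
over this specialization maps to the point. -/
theorem PlaneMorphism.range_eq_points (ξ : C.PlaneMorphism) (D : PlaneCurve K)
    (hD : ∀ (d : ℕ) (G : MvPolynomial (Fin 3) K), G.IsHomogeneous d →
      (MvPolynomial.aeval ξ.coord G = 0 ↔ D.poly ∣ G))
    (hconst : ∀ i, ξ.coord i ≠ 0 → ∃ j, ∀ c : K,
      ξ.coord j ≠ algebraMap K C.functionField c * ξ.coord i) :
    Set.range ξ.toFun = D.points := by
  apply Set.Subset.antisymm
  · rintro _ ⟨P, rfl⟩
    obtain ⟨g, v, hv, h, heq⟩ := ξ.regular P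
    rw [heq, mk_mem_points_iff]
    have h1 := Place.HasValue.mvPolynomial_aeval h D.poly
    rw [D.isHomogeneous.aeval_const_mul, (hD _ _ D.isHomogeneous).2 dvd_rfl, mul_zero] at h1
    exact h1.eq_zero
  · intro Q hQ
    induction Q using Projectivization.ind with
    | h v hv =>
    rw [mk_mem_points_iff] at hQ
    obtain ⟨i, hi⟩ := Function.ne_iff.1 hv
    have hi : v i ≠ 0 := hi
    have hfi : ξ.coord i ≠ 0 := by
      intro h0
      have := (hD 1 (MvPolynomial.X i) (MvPolynomial.isHomogeneous_X _ _)).1 (by simpa using h0)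
      obtain ⟨T, hT⟩ := this
      have := congrArg (MvPolynomial.eval v) hT
      rw [map_mul, hQ, zero_mul, MvPolynomial.eval_X] at this
      exact hi this
    set g : C.functionField := (ξ.coord i)⁻¹ with hg
    set w : Fin 3 → K := fun j => (v i)⁻¹ * v j with hw
    have hker : ∀ G : MvPolynomial (Fin 3) K,
        MvPolynomial.aeval (fun j => g * ξ.coord j) G = 0 → MvPolynomial.aeval w G = 0 := by
      intro G hG
      set M := G.totalDegree with hM
      -- Homogenization of `G` by the `i`-th variable, whose coordinate is `1` both for the ratios
      -- and for `w`; it brings `G` within reach of `hD`, which concerns forms only.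
      set H : MvPolynomial (Fin 3) K := ∑ k ∈ Finset.range (M + 1),
        MvPolynomial.homogeneousComponent k G * MvPolynomial.X i ^ (M - k) with hH
      have hHh : H.IsHomogeneous M := by
        refine MvPolynomial.IsHomogeneous.sum _ _ _ fun k hk => ?_
        have hk' : k ≤ M := Nat.lt_succ_iff.1 (Finset.mem_range.1 hk)
        have := (MvPolynomial.homogeneousComponent_isHomogeneous k G).mul
          (MvPolynomial.isHomogeneous_X_pow (R := K) i (M - k))
        rwa [Nat.add_sub_cancel' hk'] at this
      have hHG : ∀ {S : Type _} [CommRing S] [Algebra K S] (u : Fin 3 → S), u i = 1 →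
          MvPolynomial.aeval u H = MvPolynomial.aeval u G := by
        intro S _ _ u hu
        conv_rhs => rw [← MvPolynomial.sum_homogeneousComponent G]
        rw [hH, map_sum, map_sum]
        refine Finset.sum_congr rfl fun k _ => ?_
        rw [map_mul, map_pow, MvPolynomial.aeval_X, hu, one_pow, mul_one]
      have h1 : MvPolynomial.aeval ξ.coord H = 0 := by
        have h2 := hHG (fun j => g * ξ.coord j) (inv_mul_cancel₀ hfi)
        rw [hG, hHh.aeval_const_mul, mul_eq_zero] at h2
        exact h2.resolve_left (pow_ne_zero _ (inv_ne_zero hfi))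
      obtain ⟨T, hT⟩ := (hD M H hHh).1 h1
      rw [← hHG w (inv_mul_cancel₀ hi), hHh.aeval_const_mul, hT, map_mul,
        MvPolynomial.aeval_eq_eval, hQ]
      simp
    obtain ⟨O, hO, hval⟩ := exists_valuationSubring_of_ker_le _ _ hker
    have hval' : ∀ j, g * ξ.coord j - algebraMap K _ (w j) ∈ O.nonunits := fun j => by
      simpa using hval (MvPolynomial.X j)
    -- The only nonunit of `⊤` is `0`, so the trivial ring would make every ratio of coordinates
    -- constant.
    have htop : O ≠ ⊤ := by
      intro h
      obtain ⟨j, hj⟩ := hconst i hfi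
      have h1 := hval' j
      rw [ValuationSubring.mem_nonunits_iff_or, h] at h1
      have h2 := h1.resolve_right fun h3 => h3 (ValuationSubring.mem_top _)
      apply hj (w j)
      rw [sub_eq_zero, hg, inv_mul_eq_iff_eq_mul₀ hfi] at h2
      rw [h2, mul_comm]
    let P : C.SmoothModel := ⟨O, fun c => by simpa using hO (MvPolynomial.C c), htop⟩
    have hw0 : w ≠ 0 := by
      intro h
      have := congrFun h i
      simp [hw, hi] at this
    refine ⟨P, ?_⟩
    rw [ξ.toFun_eq P g w hw0 hval', Projectivization.mk_eq_mk_iff']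
    exact ⟨(v i)⁻¹, rfl⟩

end PlaneCurve

/-! ### The grading on the cone over a plane curve -/

theorem MvPolynomial.isHomogeneous_of_dvd_homogeneousComponent {K σ : Type*} [Field K]
    {P : MvPolynomial σ K} (hP : P ≠ 0)
    (h : P ∣ MvPolynomial.homogeneousComponent P.totalDegree P) :
    P.IsHomogeneous P.totalDegree := by
  set m := P.totalDegree with hm
  set H := MvPolynomial.homogeneousComponent m P with hH
  have hHh : H.IsHomogeneous m := MvPolynomial.homogeneousComponent_isHomogeneous m P
  have hH0 : H ≠ 0 := by
    obtain ⟨d, hd, hd'⟩ := Finset.exists_mem_eq_sup P.support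
      (MvPolynomial.support_nonempty.2 hP) fun s => s.sum fun _ e => e
    intro h0
    have h1 := congrArg (MvPolynomial.coeff d) h0
    have hdeg : d.degree = m := by
      rw [hm, MvPolynomial.totalDegree, hd']
      rfl
    rw [hH, MvPolynomial.coeff_homogeneousComponent, if_pos hdeg, MvPolynomial.coeff_zero] at h1
    exact MvPolynomial.mem_support_iff.1 hd h1
  obtain ⟨Q, hQ⟩ := h
  have hQ0 : Q ≠ 0 := by
    rintro rfl
    exact hH0 (by rw [hQ, mul_zero])
  have hdeg := congrArg MvPolynomial.totalDegree hQ
  rw [hHh.totalDegree hH0, MvPolynomial.totalDegree_mul_of_isDomain hP hQ0] at hdeg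
  have hQd : Q.totalDegree = 0 := by omega
  obtain ⟨c, hc⟩ : ∃ c, Q = MvPolynomial.C c := ⟨_, MvPolynomial.totalDegree_eq_zero_iff_eq_C.1 hQd⟩
  have hc0 : c ≠ 0 := by
    rintro rfl
    exact hQ0 (by rw [hc, map_zero])
  have : P = H * MvPolynomial.C c⁻¹ := by
    rw [hQ, hc, mul_assoc, ← map_mul, mul_inv_cancel₀ hc0, map_one, mul_one]
  rw [this]
  simpa using hHh.mul (MvPolynomial.isHomogeneous_C σ c⁻¹)

namespace PlaneCurve

variable {K : Type*} [Field K] (C : PlaneCurve K)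

theorem cls_eq_zero_iff (G : MvPolynomial (Fin 3) K) : C.cls G = 0 ↔ C.poly ∣ G := by
  rw [cls, map_eq_zero_iff _ (IsFractionRing.injective C.CoordRing C.ConeField),
    Ideal.Quotient.eq_zero_iff_mem, Ideal.mem_span_singleton]

theorem aeval_cls_X (G : MvPolynomial (Fin 3) K) :
    MvPolynomial.aeval (fun i => C.cls (MvPolynomial.X i)) G = C.cls G := by
  let φ : MvPolynomial (Fin 3) K →ₐ[K] C.ConeField :=
    (IsScalarTower.toAlgHom K C.CoordRing C.ConeField).comp
      (Ideal.Quotient.mkₐ K (Ideal.span {C.poly}))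
  have : MvPolynomial.aeval (fun i => C.cls (MvPolynomial.X i)) = φ :=
    MvPolynomial.algHom_ext fun i => by
      rw [MvPolynomial.aeval_X]
      rfl
  rw [this]
  rfl

theorem exists_coneField_algHom {E : Type*} [Field E] [Algebra K E] (u : Fin 3 → E)
    (hu : ∀ G, MvPolynomial.aeval u G = 0 ↔ C.poly ∣ G) :
    ∃ e : C.ConeField →ₐ[K] E, ∀ G, e (C.cls G) = MvPolynomial.aeval u G := by
  let g : C.CoordRing →ₐ[K] E := Ideal.Quotient.liftₐ (Ideal.span {C.poly}) (MvPolynomial.aeval u)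
    fun a ha => (hu a).2 (Ideal.mem_span_singleton.1 ha)
  have hg : ∀ G, g (Ideal.Quotient.mk _ G) = MvPolynomial.aeval u G := fun G => rfl
  have hinj : Function.Injective g := by
    rw [injective_iff_map_eq_zero]
    intro a ha
    obtain ⟨G, rfl⟩ := Ideal.Quotient.mk_surjective a
    rw [hg, hu] at ha
    exact Ideal.Quotient.eq_zero_iff_mem.2 (Ideal.mem_span_singleton.2 ha)
  refine ⟨IsFractionRing.liftAlgHom hinj, fun G => ?_⟩
  rw [cls, IsFractionRing.liftAlgHom_apply, IsFractionRing.lift_algebraMap]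
  exact hg G

theorem ratio_mem_functionField {d : ℕ} {G H : MvPolynomial (Fin 3) K} (hG : G.IsHomogeneous d)
    (hH : H.IsHomogeneous d) : C.cls G / C.cls H ∈ C.functionField := by
  by_cases h0 : C.cls H = 0
  · rw [h0, div_zero]
    exact zero_mem _
  · exact subset_adjoin _ _ ⟨d, G, H, hG, hH, h0, rfl⟩

/-- The endomorphism of the field of fractions of the homogeneous coordinate ring that multiplies
the coordinates by a nonzero scalar. -/
theorem exists_scaling {c : K} (hc : c ≠ 0) :
    ∃ σ : C.ConeField →ₐ[K] C.ConeField,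
      (∀ (d : ℕ) (G : MvPolynomial (Fin 3) K), G.IsHomogeneous d →
        σ (C.cls G) = algebraMap K _ c ^ d * C.cls G) ∧ ∀ t ∈ C.functionField, σ t = t := by
  have hβ : ∀ (a : K) (d : ℕ) (G : MvPolynomial (Fin 3) K), G.IsHomogeneous d →
      MvPolynomial.aeval (fun i => algebraMap K _ a * C.cls (MvPolynomial.X i)) G =
        algebraMap K C.ConeField a ^ d * C.cls G := fun a d G hG => by
    rw [hG.aeval_const_mul, aeval_cls_X]
  have hcE : algebraMap K C.ConeField c ≠ 0 := (_root_.map_ne_zero _).2 hc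
  set u : Fin 3 → C.ConeField := fun i => algebraMap K _ c * C.cls (MvPolynomial.X i) with hu
  let b (a : K) : MvPolynomial (Fin 3) K →ₐ[K] MvPolynomial (Fin 3) K :=
    MvPolynomial.aeval fun i => MvPolynomial.C a * MvPolynomial.X i
  have hb : ∀ a, C.poly ∣ b a C.poly := fun a => by
    have := C.isHomogeneous.aeval_const_mul (MvPolynomial.C a)
      (MvPolynomial.X : Fin 3 → MvPolynomial (Fin 3) K)
    change C.poly ∣ MvPolynomial.aeval _ _
    rw [this, MvPolynomial.aeval_X_left_apply]
    exact dvd_mul_left _ _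
  have hbX : ∀ a i, b a (MvPolynomial.X i) = MvPolynomial.C a * MvPolynomial.X i :=
    fun a i => MvPolynomial.aeval_X _ _
  have hbC : ∀ a k, b a (MvPolynomial.C k) = MvPolynomial.C k := fun a k => (b a).commutes k
  have hbb : ∀ G, b c⁻¹ (b c G) = G := fun G => by
    have : (b c⁻¹).comp (b c) = AlgHom.id K _ := MvPolynomial.algHom_ext fun i => by
      rw [AlgHom.comp_apply, hbX, map_mul, hbX, hbC, ← mul_assoc, ← map_mul, mul_inv_cancel₀ hc,
        map_one, one_mul, AlgHom.id_apply]
    exact DFunLike.congr_fun this G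
  have hcls : ∀ G, MvPolynomial.aeval u G = C.cls (b c G) := fun G => by
    rw [← aeval_cls_X, ← AlgHom.comp_apply]
    congr 1
    refine MvPolynomial.algHom_ext fun i => ?_
    simp [b, hu, ← MvPolynomial.algebraMap_eq]
  obtain ⟨σ, hσ⟩ := C.exists_coneField_algHom u fun G => by
    rw [hcls, cls_eq_zero_iff]
    constructor
    · rintro ⟨T, hT⟩
      rw [← hbb G, hT, map_mul]
      exact (hb _).mul_right _
    · rintro ⟨T, rfl⟩
      rw [map_mul]
      exact (hb _).mul_right _
  have h1 : ∀ (d : ℕ) (G : MvPolynomial (Fin 3) K), G.IsHomogeneous d →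
      σ (C.cls G) = algebraMap K _ c ^ d * C.cls G := fun d G hG => by rw [hσ, hβ c d G hG]
  refine ⟨σ, h1, fun t ht => ?_⟩
  induction ht using IntermediateField.adjoin_induction with
  | mem t ht =>
    obtain ⟨d, G, H, hG, hH, h0, rfl⟩ := ht
    rw [map_div₀, h1 d G hG, h1 d H hH, mul_div_mul_left _ _ (pow_ne_zero _ hcE)]
  | algebraMap a => exact σ.commutes a
  | add s t _ _ hs ht => rw [map_add, hs, ht]
  | inv s _ hs => rw [map_inv₀, hs]
  | mul s t _ _ hs ht => rw [map_mul, hs, ht]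

theorem coe_aeval (f : Fin 3 → C.functionField) (G : MvPolynomial (Fin 3) K) :
    ((MvPolynomial.aeval f G : C.functionField) : C.ConeField) =
      MvPolynomial.aeval (fun i => (f i : C.ConeField)) G :=
  MvPolynomial.comp_aeval_apply f C.functionField.val G

/-- The relations among the `w f i` form a homogeneous ideal. Scaling the cone by `c` multiplies the
degree `k` part of a relation by `c ^ k`, so the parts are the coefficients of a polynomial
vanishing at every nonzero constant. -/
theorem aeval_homogeneousComponent_eq_zero [Infinite K] {w : C.ConeField}
    {H : MvPolynomial (Fin 3) K} (hH : H.IsHomogeneous 1) (hw : w = C.cls H)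
    (f : Fin 3 → C.functionField) (G : MvPolynomial (Fin 3) K)
    (hG : MvPolynomial.aeval (fun i => w * (f i : C.ConeField)) G = 0) (d : ℕ) :
    MvPolynomial.aeval (fun i => w * (f i : C.ConeField))
      (MvPolynomial.homogeneousComponent d G) = 0 := by
  set g : ℕ → C.ConeField := fun k => MvPolynomial.aeval (fun i => w * (f i : C.ConeField))
      (MvPolynomial.homogeneousComponent k G) with hg
  have hgk : ∀ k, g k = w ^ k *
      (MvPolynomial.aeval f (MvPolynomial.homogeneousComponent k G) : _) :=
    fun k => by
      rw [hg, coe_aeval]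
      exact (MvPolynomial.homogeneousComponent_isHomogeneous k G).aeval_const_mul _ _
  set p : C.ConeField[X] := ∑ k ∈ Finset.range (G.totalDegree + 1), monomial k (g k) with hp
  have hroot : ∀ c : K, c ≠ 0 → p.IsRoot (algebraMap K _ c) := by
    intro c hc
    obtain ⟨σ, hσ, hσf⟩ := C.exists_scaling hc
    have h1 : ∀ k, σ (g k) = g k * algebraMap K _ c ^ k := fun k => by
      rw [hgk, map_mul, map_pow, hw, hσ 1 H hH, hσf _ (SetLike.coe_mem _)]
      ring
    have h2 : ∑ k ∈ Finset.range (G.totalDegree + 1), g k = 0 := by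
      rw [hg, ← map_sum, MvPolynomial.sum_homogeneousComponent, hG]
    rw [IsRoot.def, hp, eval_finsetSum]
    simp only [eval_monomial, ← h1]
    rw [← map_sum, h2, map_zero]
  have hp0 : p = 0 := by
    refine eq_zero_of_infinite_isRoot p ?_
    have hinf : (Set.univ \ {(0 : K)}).Infinite := Set.infinite_univ.sdiff (Set.finite_singleton _)
    refine (hinf.image (algebraMap K C.ConeField).injective.injOn).mono ?_
    rintro _ ⟨c, ⟨-, hc⟩, rfl⟩
    exact hroot c hc
  by_cases hd : d ≤ G.totalDegree
  · have h3 := congrArg (fun p => coeff p d) hp0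
    simp only [hp, finsetSum_coeff, coeff_monomial, coeff_zero] at h3
    rw [Finset.sum_ite_eq' , if_pos (Finset.mem_range.2 (by omega))] at h3
    exact h3
  · rw [MvPolynomial.homogeneousComponent_eq_zero _ _ (not_le.1 hd), map_zero]

end PlaneCurve

/-! ### The equation of the image as a minimal polynomial -/

/-- Over an integrally closed `A` the minimal polynomial of an integral element is that over the
fraction field, so its degree is that of the field generated; here `s` and `t` generate the same
one. -/
theorem minpoly.natDegree_eq_of_forall_subfield_mem_iff {A E : Type*} [CommRing A] [IsDomain A]
    [IsIntegrallyClosed A] [Field E] [Algebra A E] [FaithfulSMul A E] {s t : E}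
    (hs : IsIntegral A s) (ht : IsIntegral A t)
    (h : ∀ M : Subfield E, (∀ a, algebraMap A E a ∈ M) → (s ∈ M ↔ t ∈ M)) :
    (minpoly A s).natDegree = (minpoly A t).natDegree := by
  let k := FractionRing A
  let _ : Algebra k E := FractionRing.liftAlgebra A E
  have hA : ∀ (M : IntermediateField k E) a, algebraMap A E a ∈ M.toSubfield := fun M a => by
    rw [IsScalarTower.algebraMap_apply A k E]
    exact M.algebraMap_mem _
  have hdeg : ∀ {z : E}, IsIntegral A z →
      (minpoly A z).natDegree = Module.finrank k k⟮z⟯ := fun {z} hz => by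
    rw [adjoin.finrank (hz.tower_top (A := k)), minpoly.isIntegrallyClosed_eq_field_fractions' k hz,
      (minpoly.monic hz).natDegree_map]
  have heq : k⟮s⟯ = k⟮t⟯ := by
    apply le_antisymm
    · rw [adjoin_simple_le_iff]
      exact (h k⟮t⟯.toSubfield (hA _)).2 (mem_adjoin_simple_self k t)
    · rw [adjoin_simple_le_iff]
      exact (h k⟮s⟯.toSubfield (hA _)).1 (mem_adjoin_simple_self k s)
  rw [hdeg hs, hdeg ht, heq]

/-- The identification of `K[X₀, X₁, X₂]` with `K[X₀, X₂][X₁]`. -/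
noncomputable def middleEquiv (K : Type*) [Field K] :
    MvPolynomial (Fin 3) K ≃ₐ[K] (MvPolynomial (Fin 2) K)[X] :=
  (MvPolynomial.renameEquiv K (Equiv.swap (0 : Fin 3) 1)).trans (MvPolynomial.finSuccEquiv K 2)

section

variable {K : Type*} [Field K]

theorem middleEquiv_X_zero :
    middleEquiv K (MvPolynomial.X 0) = C (MvPolynomial.X 0) := by
  have := MvPolynomial.finSuccEquiv_X_succ (R := K) (n := 2) (j := 0)
  simpa [middleEquiv] using this

theorem middleEquiv_X_one :
    middleEquiv K (MvPolynomial.X 1) = X := by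
  simp [middleEquiv, MvPolynomial.finSuccEquiv_X_zero]

theorem middleEquiv_X_two :
    middleEquiv K (MvPolynomial.X 2) = C (MvPolynomial.X 1) := by
  have := MvPolynomial.finSuccEquiv_X_succ (R := K) (n := 2) (j := 1)
  have hs : (Equiv.swap (0 : Fin 3) 1) 2 = 2 := by decide
  simpa [middleEquiv, hs] using this

theorem aeval_eq_aeval_middleEquiv {S : Type*} [CommRing S] [Algebra K S]
    [Algebra (MvPolynomial (Fin 2) K) S] [IsScalarTower K (MvPolynomial (Fin 2) K) S]
    (u : Fin 3 → S) (h0 : algebraMap (MvPolynomial (Fin 2) K) S (MvPolynomial.X 0) = u 0)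
    (h2 : algebraMap (MvPolynomial (Fin 2) K) S (MvPolynomial.X 1) = u 2)
    (G : MvPolynomial (Fin 3) K) :
    MvPolynomial.aeval u G = Polynomial.aeval (u 1) (middleEquiv K G) := by
  have : MvPolynomial.aeval u = ((Polynomial.aeval (R := MvPolynomial (Fin 2) K)
      (u 1)).restrictScalars K).comp (middleEquiv K).toAlgHom := by
    refine MvPolynomial.algHom_ext fun i => ?_
    rw [MvPolynomial.aeval_X, AlgHom.comp_apply]
    change u i = Polynomial.aeval (u 1) (middleEquiv K (MvPolynomial.X i))
    fin_cases i
    · simp [middleEquiv_X_zero, h0]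
    · simp [middleEquiv_X_one]
    · simp [middleEquiv_X_two, h2]
  rw [this]
  rfl

/-- Restrict to the line `(0, T, 0)`: a form of degree `m` becomes a constant times `T ^ m`, while
monicity in the middle variable preserves the degree in it. -/
theorem MvPolynomial.IsHomogeneous.eq_natDegree_middleEquiv {P : MvPolynomial (Fin 3) K} {m : ℕ}
    (hP : P.IsHomogeneous m) (hm : (middleEquiv K P).Monic) :
    m = (middleEquiv K P).natDegree := by
  let _ : Algebra (MvPolynomial (Fin 2) K) K[X] :=
    (MvPolynomial.aeval (fun _ => (0 : K[X])) :
      MvPolynomial (Fin 2) K →ₐ[K] K[X]).toRingHom.toAlgebra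
  have : IsScalarTower K (MvPolynomial (Fin 2) K) K[X] := .of_algebraMap_eq fun c =>
    ((MvPolynomial.aeval (fun _ => (0 : K[X])) :
      MvPolynomial (Fin 2) K →ₐ[K] K[X]).commutes c).symm
  have h1 := aeval_eq_aeval_middleEquiv (fun i : Fin 3 => Polynomial.X * ![(0 : K[X]), 1, 0] i)
    (by simp [RingHom.algebraMap_toAlgebra]) (by simp [RingHom.algebraMap_toAlgebra]) P
  rw [hP.aeval_const_mul] at h1
  simp only [Matrix.cons_val_one, Matrix.cons_val_zero, mul_one] at h1
  set Q := middleEquiv K P with hQ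
  have h2 : Polynomial.aeval (Polynomial.X : K[X]) Q =
      Q.map (MvPolynomial.aeval (fun _ => (0 : K)) : MvPolynomial (Fin 2) K →ₐ[K] K).toRingHom := by
    rw [Polynomial.aeval_def, Polynomial.map]
    congr 1
    refine MvPolynomial.ringHom_ext (fun c => ?_) fun i => ?_
    · simp [RingHom.algebraMap_toAlgebra]
    · simp [RingHom.algebraMap_toAlgebra]
  have h3 : MvPolynomial.aeval ![(0 : K[X]), 1, 0] P =
      Polynomial.C (MvPolynomial.aeval ![(0 : K), 1, 0] P) := by
    have := MvPolynomial.comp_aeval_apply ![(0 : K), 1, 0] (Algebra.ofId K K[X]) P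
    change Polynomial.C _ = _ at this
    rw [this]
    congr 2
    funext i
    fin_cases i <;> simp
  rw [h2, h3] at h1
  have h4 := hm.natDegree_map
    (MvPolynomial.aeval (fun _ => (0 : K)) : MvPolynomial (Fin 2) K →ₐ[K] K).toRingHom
  have h5 := (hm.map
    (MvPolynomial.aeval (fun _ => (0 : K)) : MvPolynomial (Fin 2) K →ₐ[K] K).toRingHom).ne_zero
  rw [← h1] at h4 h5
  have h6 : MvPolynomial.aeval ![(0 : K), 1, 0] P ≠ 0 := by
    intro h
    rw [h, map_zero, mul_zero] at h5
    exact h5 rfl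
  rw [mul_comm, natDegree_C_mul_X_pow _ _ h6] at h4
  exact h4

/-- If `F` generates the relations between `x₀, x₁, x₂`, where `x₁` is integral over `K[x₀, x₂]`,
and `t` is another integral generator of the same field, then the relations between `x₀, t, x₂` are
generated by a form which has the same degree in the middle variable. -/
theorem exists_irreducible_of_isIntegralElem {E : Type*} [Field E] [Algebra K E]
    {F : MvPolynomial (Fin 3) K} (hF : Irreducible F) (hmon : (middleEquiv K F).Monic)
    {x u : Fin 3 → E} (hx : ∀ G, MvPolynomial.aeval x G = 0 ↔ F ∣ G) (h0 : u 0 = x 0)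
    (h2 : u 2 = x 2)
    (hint : (MvPolynomial.aeval ![x 0, x 2] :
      MvPolynomial (Fin 2) K →ₐ[K] E).toRingHom.IsIntegralElem (u 1))
    (hgen : ∀ M : IntermediateField K E, x 0 ∈ M → x 2 ∈ M → (x 1 ∈ M ↔ u 1 ∈ M)) :
    ∃ P : MvPolynomial (Fin 3) K, Irreducible P ∧ (middleEquiv K P).Monic ∧
      (middleEquiv K P).natDegree = (middleEquiv K F).natDegree ∧
      ∀ G, MvPolynomial.aeval u G = 0 ↔ P ∣ G := by
  set A := MvPolynomial (Fin 2) K with hA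
  set ι : A →ₐ[K] E := MvPolynomial.aeval ![x 0, x 2] with hι
  let _ : Algebra A E := ι.toRingHom.toAlgebra
  have hιa : ∀ a, algebraMap A E a = ι a := fun _ => rfl
  have : IsScalarTower K A E := .of_algebraMap_eq fun c => (ι.commutes c).symm
  have hι0 : algebraMap A E (MvPolynomial.X 0) = x 0 := by
    rw [hιa, hι]
    exact MvPolynomial.aeval_X _ _
  have hι1 : algebraMap A E (MvPolynomial.X 1) = x 2 := by
    rw [hιa, hι]
    exact MvPolynomial.aeval_X _ _
  have hX := aeval_eq_aeval_middleEquiv x hι0 hι1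
  have hU := aeval_eq_aeval_middleEquiv u (hι0.trans h0.symm) (hι1.trans h2.symm)
  have hQirr : Irreducible (middleEquiv K F) := (MulEquiv.irreducible_iff (middleEquiv K)).2 hF
  have hQroot : Polynomial.aeval (x 1) (middleEquiv K F) = 0 := by
    rw [← hX, hx]
  -- The elements `x 0` and `x 2` are algebraically independent: a relation between them is constant
  -- in the middle variable, in which its divisor `F` has positive degree.
  have hfaith : FaithfulSMul A E := by
    rw [faithfulSMul_iff_algebraMap_injective, injective_iff_map_eq_zero]
    intro a ha
    have h1 : MvPolynomial.aeval x ((middleEquiv K).symm (C a)) = 0 := by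
      rw [hX, AlgEquiv.apply_symm_apply, aeval_C, ha]
    rw [hx] at h1
    obtain ⟨T, hT⟩ := h1
    have h2 := congrArg (middleEquiv K) hT
    rw [AlgEquiv.apply_symm_apply, map_mul] at h2
    have h3 := eq_zero_of_dvd_of_natDegree_lt ⟨_, h2⟩ (by
      rw [natDegree_C]
      exact hmon.natDegree_pos_of_not_isUnit hQirr.not_isUnit)
    exact C_eq_zero.1 h3
  have hYint : IsIntegral A (x 1) := ⟨_, hmon, hQroot⟩
  have hZint : IsIntegral A (u 1) := hint
  have hQmin : minpoly A (x 1) = middleEquiv K F := by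
    refine eq_of_monic_of_associated (minpoly.monic hYint) hmon ?_
    exact (minpoly.prime_of_isIntegrallyClosed hYint).irreducible.associated_of_dvd hQirr
      (minpoly.isIntegrallyClosed_dvd hYint hQroot)
  have hdeg := minpoly.natDegree_eq_of_forall_subfield_mem_iff hYint hZint fun M hM => by
    have hK : ∀ c : K, algebraMap K E c ∈ M := fun c => by
      rw [IsScalarTower.algebraMap_apply K A E]
      exact hM _
    exact hgen ⟨⟨M.toSubring.toSubsemiring, hK⟩, fun x hx => M.inv_mem hx⟩
      (hι0 ▸ hM _) (hι1 ▸ hM _)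
  have hPe : middleEquiv K ((middleEquiv K).symm (minpoly A (u 1))) = minpoly A (u 1) :=
    AlgEquiv.apply_symm_apply _ _
  refine ⟨(middleEquiv K).symm (minpoly A (u 1)), ?_, ?_, ?_, fun G => ?_⟩
  · rw [← MulEquiv.irreducible_iff (middleEquiv K), hPe]
    exact (minpoly.prime_of_isIntegrallyClosed hZint).irreducible
  · rw [hPe]
    exact minpoly.monic hZint
  · rw [hPe, ← hdeg, hQmin]
  · rw [hU, minpoly.isIntegrallyClosed_dvd_iff hZint]
    nth_rewrite 1 [← hPe]
    exact map_dvd_iff (middleEquiv K)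

/-- The generator of the relations divides its own top component, which is again a relation, so it
is a form. Being monic in the middle variable, it has total degree equal to its degree there, which
is that of the equation of `C₀`. -/
theorem exists_planeCurve_of_coord [Infinite K] (C₀ : PlaneCurve K)
    (hmon : (middleEquiv K C₀.poly).Monic) (f : Fin 3 → C₀.functionField)
    {u : Fin 3 → C₀.ConeField} (hu : u = fun i => C₀.cls (MvPolynomial.X 2) * (f i : C₀.ConeField))
    (h0 : u 0 = C₀.cls (MvPolynomial.X 0)) (h2 : u 2 = C₀.cls (MvPolynomial.X 2))
    (hint : (MvPolynomial.aeval ![C₀.cls (MvPolynomial.X 0), C₀.cls (MvPolynomial.X 2)] :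
      MvPolynomial (Fin 2) K →ₐ[K] C₀.ConeField).toRingHom.IsIntegralElem (u 1))
    (hgen : ∀ M : IntermediateField K C₀.ConeField, C₀.cls (MvPolynomial.X 0) ∈ M →
      C₀.cls (MvPolynomial.X 2) ∈ M → (C₀.cls (MvPolynomial.X 1) ∈ M ↔ u 1 ∈ M)) :
    ∃ D : PlaneCurve K, D.degree = C₀.degree ∧
      ∀ G, MvPolynomial.aeval u G = 0 ↔ D.poly ∣ G := by
  obtain ⟨P, hPirr, hPmon, hPdeg, hker⟩ := exists_irreducible_of_isIntegralElem
    (x := fun i => C₀.cls (MvPolynomial.X i)) C₀.irreducible hmon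
    (fun G => by rw [C₀.aeval_cls_X, C₀.cls_eq_zero_iff]) h0 h2 hint hgen
  have hPhom : P.IsHomogeneous P.totalDegree := by
    refine MvPolynomial.isHomogeneous_of_dvd_homogeneousComponent hPirr.ne_zero ?_
    rw [← hker, hu]
    refine C₀.aeval_homogeneousComponent_eq_zero (MvPolynomial.isHomogeneous_X K 2) rfl f P ?_ _
    rw [← hu, hker]
  refine ⟨⟨P, hPirr, hPhom⟩, ?_, hker⟩
  change P.totalDegree = C₀.poly.totalDegree
  rw [hPhom.eq_natDegree_middleEquiv hPmon, C₀.isHomogeneous.eq_natDegree_middleEquiv hmon, hPdeg]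

end

/-! ### Pull-back of function fields and of projections -/

section

variable {K : Type*} [Field K]

namespace PlaneCurve

theorem functionField_eq_top_of_mem {C : PlaneCurve K} (hW : C.cls (MvPolynomial.X 2) ≠ 0)
    {g : Fin 3 → C.functionField}
    (hg : ∀ i, (g i : C.ConeField) = C.cls (MvPolynomial.X i) / C.cls (MvPolynomial.X 2))
    (M : IntermediateField K C.functionField) (hM : ∀ i, g i ∈ M) : M = ⊤ := by
  have hcls : ∀ (d : ℕ) (G : MvPolynomial (Fin 3) K), G.IsHomogeneous d →
      C.cls G = C.cls (MvPolynomial.X 2) ^ d * (MvPolynomial.aeval g G : C.functionField) := by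
    intro d G hG
    rw [coe_aeval, ← hG.aeval_const_mul, ← C.aeval_cls_X]
    congr 2
    funext i
    rw [hg, mul_div_cancel₀ _ hW]
  have hle : C.functionField ≤ M.map C.functionField.val := by
    refine adjoin_le_iff.2 ?_
    rintro _ ⟨d, G, H, hG, hH, -, rfl⟩
    refine ⟨MvPolynomial.aeval g G / MvPolynomial.aeval g H, ?_, ?_⟩
    · have hpoly : ∀ G : MvPolynomial (Fin 3) K, MvPolynomial.aeval g G ∈ M := fun G => by
        induction G using MvPolynomial.induction_on with
        | C a => rw [MvPolynomial.aeval_C]; exact M.algebraMap_mem a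
        | add p q hp hq => rw [map_add]; exact add_mem hp hq
        | mul_X p i hp => rw [map_mul, MvPolynomial.aeval_X]; exact mul_mem hp (hM i)
      exact M.div_mem (hpoly G) (hpoly H)
    · rw [hcls d G hG, hcls d H hH, mul_div_mul_left _ _ (pow_ne_zero _ hW)]
      exact map_div₀ C.functionField.val _ _
  rw [eq_top_iff]
  intro t _
  obtain ⟨s, hs, hst⟩ := hle t.2
  rwa [← Subtype.ext hst]

theorem aeval_eq_zero_iff_of_cone {C D : PlaneCurve K} {f : Fin 3 → C.functionField}
    {w : C.ConeField} (hw : w ≠ 0)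
    (hker : ∀ G, MvPolynomial.aeval (fun i => w * (f i : C.ConeField)) G = 0 ↔ D.poly ∣ G)
    (d : ℕ) (G : MvPolynomial (Fin 3) K) (hG : G.IsHomogeneous d) :
    MvPolynomial.aeval f G = 0 ↔ D.poly ∣ G := by
  rw [← hker, hG.aeval_const_mul, ← coe_aeval, mul_eq_zero, or_iff_right (pow_ne_zero _ hw),
    ZeroMemClass.coe_eq_zero]

/-- The pull-back of rational functions along `(f₀ : f₁ : f₂)`. -/
def IsPullback {C D : PlaneCurve K} (f : Fin 3 → C.functionField)
    (e : D.functionField ≃ₐ[K] C.functionField) : Prop :=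
  ∀ (d : ℕ) (G H : MvPolynomial (Fin 3) K), G.IsHomogeneous d → H.IsHomogeneous d →
    D.cls H ≠ 0 → ∀ u : D.functionField, (u : D.ConeField) = D.cls G / D.cls H →
      e u = MvPolynomial.aeval f G / MvPolynomial.aeval f H

/-- The coordinates of `D` go to `w f i`, which embeds the field of its cone; in a ratio of forms of
equal degree the powers of `w` cancel, so function fields correspond. -/
theorem exists_isPullback {C D : PlaneCurve K} {f : Fin 3 → C.functionField}
    {w : C.ConeField} (hw : w ≠ 0)
    (hker : ∀ G, MvPolynomial.aeval (fun i => w * (f i : C.ConeField)) G = 0 ↔ D.poly ∣ G)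
    (htop : ∀ M : IntermediateField K C.functionField, (∀ i j, f i / f j ∈ M) → M = ⊤) :
    ∃ e : D.functionField ≃ₐ[K] C.functionField, IsPullback f e := by
  obtain ⟨e₀, he₀⟩ := D.exists_coneField_algHom _ hker
  have hratio : ∀ (d : ℕ) (G H : MvPolynomial (Fin 3) K), G.IsHomogeneous d → H.IsHomogeneous d →
      e₀ (D.cls G / D.cls H) =
        (MvPolynomial.aeval f G / MvPolynomial.aeval f H : C.functionField) := by
    intro d G H hG hH
    rw [map_div₀, he₀, he₀, hG.aeval_const_mul, hH.aeval_const_mul,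
      mul_div_mul_left _ _ (pow_ne_zero _ hw), ← coe_aeval, ← coe_aeval]
    exact (map_div₀ C.functionField.val _ _).symm
  have hmap : D.functionField.map e₀ = C.functionField := by
    apply le_antisymm
    · rw [functionField, adjoin_map, adjoin_le_iff]
      rintro _ ⟨_, ⟨d, G, H, hG, hH, -, rfl⟩, rfl⟩
      change e₀ _ ∈ _
      rw [hratio d G H hG hH]
      exact SetLike.coe_mem _
    · have h := htop ((D.functionField.map e₀).comap C.functionField.val) fun i j => by
        refine ⟨D.cls (MvPolynomial.X i) / D.cls (MvPolynomial.X j), ?_, ?_⟩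
        · exact D.ratio_mem_functionField (MvPolynomial.isHomogeneous_X _ _)
            (MvPolynomial.isHomogeneous_X _ _)
        · have := hratio 1 _ _ (MvPolynomial.isHomogeneous_X K i) (MvPolynomial.isHomogeneous_X K j)
          rw [MvPolynomial.aeval_X, MvPolynomial.aeval_X] at this
          exact this
      intro t ht
      have : (⟨t, ht⟩ : C.functionField) ∈ (D.functionField.map e₀).comap C.functionField.val := by
        rw [h]
        exact mem_top
      exact this
  refine ⟨(D.functionField.equivMap e₀).trans (IntermediateField.equivOfEq hmap), ?_⟩
  intro d G H hG hH _ u hu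
  apply Subtype.ext
  rw [← hratio d G H hG hH, ← hu]
  rfl

theorem map_projectionField {C D : PlaneCurve K} {f : Fin 3 → C.functionField}
    {e : D.functionField ≃ₐ[K] C.functionField} (he : IsPullback f e) (v : Fin 3 → K) (hv : v ≠ 0)
    (t : C.functionField)
    (h : ∀ ℓ : MvPolynomial (Fin 3) K, ℓ.IsHomogeneous 1 → MvPolynomial.eval v ℓ = 0 →
      MvPolynomial.aeval f ℓ ∈ K⟮t⟯)
    {ℓ₁ ℓ₂ : MvPolynomial (Fin 3) K} (h₁ : ℓ₁.IsHomogeneous 1) (h₂ : ℓ₂.IsHomogeneous 1)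
    (hv₁ : MvPolynomial.eval v ℓ₁ = 0) (hv₂ : MvPolynomial.eval v ℓ₂ = 0) (h0 : D.cls ℓ₂ ≠ 0)
    (ht : MvPolynomial.aeval f ℓ₁ / MvPolynomial.aeval f ℓ₂ = t) :
    (D.projectionField (Projectivization.mk K v hv)).map e.toAlgHom = K⟮t⟯ := by
  apply le_antisymm
  · rw [projectionField, adjoin_map, adjoin_le_iff]
    rintro _ ⟨u, ⟨m₁, m₂, hm₁, hm₂, hv₁, hv₂, hm0, hu⟩, rfl⟩
    change e u ∈ _
    rw [he 1 m₁ m₂ hm₁ hm₂ hm0 u hu]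
    rw [hm₁.eval_rep_mk_eq_zero_iff] at hv₁
    rw [hm₂.eval_rep_mk_eq_zero_iff] at hv₂
    exact K⟮t⟯.div_mem (h _ hm₁ hv₁) (h _ hm₂ hv₂)
  · rw [adjoin_simple_le_iff]
    let u : D.functionField := ⟨D.cls ℓ₁ / D.cls ℓ₂, D.ratio_mem_functionField h₁ h₂⟩
    refine ⟨u, subset_adjoin _ _ ⟨ℓ₁, ℓ₂, h₁, h₂, ?_, ?_, h0, rfl⟩, ?_⟩
    · rwa [h₁.eval_rep_mk_eq_zero_iff]
    · rwa [h₂.eval_rep_mk_eq_zero_iff]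
    · change e u = t
      rw [he 1 ℓ₁ ℓ₂ h₁ h₂ h0 u rfl, ht]

theorem isGaloisPoint_of_map_eq {C D : PlaneCurve K} (e : D.functionField ≃ₐ[K] C.functionField)
    {P : ℙ K (Fin 3 → K)} {F : IntermediateField K C.functionField}
    (h : (D.projectionField P).map e.toAlgHom = F) (hF : IsGalois F C.functionField) :
    D.IsGaloisPoint P := by
  let e₁ : D.projectionField P ≃ₐ[K] F :=
    ((D.projectionField P).equivMap e.toAlgHom).trans (IntermediateField.equivOfEq h)
  have hcomm : ∀ s : D.projectionField P,
      ((e₁ s : F) : C.functionField) = e (s : D.functionField) := fun s => rfl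
  refine IsGalois.of_equiv_equiv (F := F) (E := C.functionField) (M := D.projectionField P)
    (N := D.functionField) (f := e₁.symm.toRingEquiv) (g := e.symm.toRingEquiv) ?_
  refine RingHom.ext fun s => ?_
  obtain ⟨s, rfl⟩ := e₁.surjective s
  change ((e₁.symm (e₁ s) : D.projectionField P) : D.functionField) =
    e.symm (e₁ s : C.functionField)
  rw [hcomm, AlgEquiv.symm_apply_apply, AlgEquiv.symm_apply_apply]

theorem exists_linear_of_isHomogeneous_one {ℓ : MvPolynomial (Fin 3) K} (h : ℓ.IsHomogeneous 1) :
    ∃ a : Fin 3 → K, ℓ = ∑ i, MvPolynomial.C (a i) * MvPolynomial.X i := by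
  refine ⟨fun i => MvPolynomial.coeff (Finsupp.single i 1) ℓ, ?_⟩
  ext m
  simp only [MvPolynomial.coeff_sum, MvPolynomial.coeff_C_mul, MvPolynomial.coeff_X]
  by_cases hm : m.degree = 1
  · obtain ⟨i, rfl⟩ : ∃ i, m = Finsupp.single i 1 := by
      exact (Finsupp.sum_eq_one_iff m).1 hm
    simp [Finsupp.single_left_inj]
  · have h0 : MvPolynomial.coeff m ℓ = 0 := by
      by_contra hne
      apply hm
      have := h hne
      rw [Finsupp.degree_eq_weight_one]
      exact this
    rw [h0, Finset.sum_eq_zero]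
    intro i _
    rw [if_neg, mul_zero]
    rintro rfl
    simp at hm

end PlaneCurve

/-! ### Integrality, values and Galois property for the additive polynomial -/

/-- For a term with `s = q ^ i`, the power `(w y ^ s) ^ (q ^ r + 1)` is `w ^ (q ^ r + 1 - q s)`
times a power of `(w x) ^ q + (w x) w ^ (q - 1)`. The exponent of `w` is nonnegative because `i <
r`. -/
theorem isIntegralElem_mul_additivePoly {E : Type*} [Field E] [Algebra K E] {q r : ℕ}
    (hq : 1 < q) (b : K) {x y w : E} (h : y ^ (q ^ r + 1) = x ^ q + x) :
    (MvPolynomial.aeval ![w * x, w] : MvPolynomial (Fin 2) K →ₐ[K] E).toRingHom.IsIntegralElem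
      (w * additivePoly q r b y) := by
  set A := MvPolynomial (Fin 2) K with hA
  set ι : A →ₐ[K] E := MvPolynomial.aeval ![w * x, w] with hι
  let _ : Algebra A E := ι.toRingHom.toAlgebra
  have hιa : ∀ a, algebraMap A E a = ι a := fun _ => rfl
  change IsIntegral A (w * additivePoly q r b y)
  rw [additivePoly, Finset.mul_sum]
  refine IsIntegral.sum _ fun i hi => ?_
  have hqi : q * q ^ i < q ^ r + 1 := by
    rw [← pow_succ', Nat.lt_succ_iff]
    exact Nat.pow_le_pow_right (by omega) (Finset.mem_range.1 hi)
  rw [mul_left_comm]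
  refine IsIntegral.mul ?_ ?_
  · rw [← AlgHom.commutes ι]
    exact isIntegral_algebraMap (R := A)
  set s := q ^ i
  refine IsIntegral.of_pow (n := q ^ r + 1) (Nat.succ_pos _) ?_
  have : (w * y ^ s) ^ (q ^ r + 1) = ι (MvPolynomial.X 1 ^ (q ^ r + 1 - q * s) *
      (MvPolynomial.X 0 ^ q + MvPolynomial.X 0 * MvPolynomial.X 1 ^ (q - 1)) ^ s) := by
    have h0 : ι (MvPolynomial.X 0) = w * x := MvPolynomial.aeval_X _ _
    have h1 : ι (MvPolynomial.X 1) = w := MvPolynomial.aeval_X _ _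
    simp only [map_mul, map_pow, map_add, h0, h1]
    have h2 : (w * x) ^ q + w * x * w ^ (q - 1) = w ^ q * y ^ (q ^ r + 1) := by
      obtain ⟨k, rfl⟩ : ∃ k, q = k + 1 := ⟨q - 1, by omega⟩
      rw [h, Nat.add_sub_cancel]
      ring
    rw [h2, mul_pow, mul_pow, ← pow_mul, ← pow_mul, ← pow_mul, ← mul_assoc, ← pow_add,
      Nat.sub_add_cancel hqi.le, mul_comm s]
  rw [this, ← hιa]
  exact isIntegral_algebraMap

/-- Where `x` has a value, `y` is a root of a polynomial over `K` modulo the maximal ideal. At a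
pole, `v(y) ^ (q ^ r + 1) = v(x) ^ q`, so `v(y ^ (q ^ i)) < v(x)` amounts to `q ^ (i + 1) < q ^ r +
1`, true for `i < r`. -/
theorem Place.exists_hasValue_additivePoly [IsAlgClosed K] {L : Type*} [Field L] [Algebra K L]
    (P : Place K L) {q r : ℕ} (hq : 1 < q) (b : K) {x y : L} [IsGalois K⟮x⟯ L]
    (h : y ^ (q ^ r + 1) = x ^ q + x) :
    (∃ c d, P.HasValue x c ∧ P.HasValue (additivePoly q r b y) d) ∨
      (x ≠ 0 ∧ P.HasValue x⁻¹ 0 ∧ P.HasValue (x⁻¹ * additivePoly q r b y) 0) := by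
  by_cases hx : x ∈ P.ring
  · left
    obtain ⟨c, hc⟩ := P.exists_hasValue_of_mem hx
    have hp : (X ^ (q ^ r + 1) - C (c ^ q + c) : K[X]) ≠ 0 := X_pow_sub_C_ne_zero (Nat.succ_pos _) _
    obtain ⟨d, hd⟩ := P.exists_hasValue_of_aeval hp (f := y) (by
      have := P.hasValue_iff.1 ((hc.pow q).add hc)
      simpa [h] using this)
    exact ⟨c, additivePoly q r b d, hc, HasValue.sum fun i _ =>
      (P.hasValue_algebraMap _).mul (hd.pow _)⟩
  · right
    have hx0 : x ≠ 0 := by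
      rintro rfl
      exact hx (zero_mem _)
    rw [← ValuationSubring.valuation_le_one_iff, not_le] at hx
    set v := P.ring.valuation
    have hvx0 : v x ≠ 0 := (v.ne_zero_iff).2 hx0
    refine ⟨hx0, ?_, ?_⟩
    · rw [hasValue_iff, map_zero, sub_zero, map_inv₀]
      exact inv_lt_one_of_one_lt₀ hx
    · have hy : v y ^ (q ^ r + 1) = v x ^ q := by
        have hlt : v x < v (x ^ q) := by
          rw [map_pow]
          exact lt_self_pow₀ hx hq
        rw [← map_pow, h, Valuation.map_add_eq_of_lt_left _ hlt, map_pow]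
      have hlt : v (additivePoly q r b y) < v x := by
        refine v.map_sum_lt hvx0 fun i hi => ?_
        have hle : v (y ^ q ^ i) < v x := by
          refine lt_of_pow_lt_pow_left₀ (q ^ r + 1) zero_le ?_
          rw [map_pow, ← pow_mul, mul_comm, pow_mul, hy, ← pow_mul, ← pow_succ']
          refine pow_lt_pow_right₀ hx (Nat.lt_succ_of_le ?_)
          exact Nat.pow_le_pow_right (by omega) (Finset.mem_range.1 hi)
        rw [map_mul]
        exact (mul_le_of_le_one_left zero_le (P.valuation_algebraMap_le _)).trans_lt hle
      rw [hasValue_iff, map_zero, sub_zero, map_mul, map_inv₀, inv_mul_eq_div]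
      exact (div_lt_one₀ (zero_lt_iff.2 hvx0)).2 hlt

/-- The clause `v 2 ≠ 0 ∨ v 1 = 0` records that `(1 : 0 : 0)` is the only possible image on the line
`Z = 0`; it is what makes the two centres outer. -/
theorem Place.exists_hasValue_coord [IsAlgClosed K] {L : Type*} [Field L] [Algebra K L]
    (P : Place K L) {q r : ℕ} (hq : 1 < q) (b : K) {x y : L} [IsGalois K⟮x⟯ L]
    (h : y ^ (q ^ r + 1) = x ^ q + x) :
    ∃ (g : L) (v : Fin 3 → K), v ≠ 0 ∧ (v 2 ≠ 0 ∨ v 1 = 0) ∧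
      ∀ i, P.HasValue (g * ![x, additivePoly q r b y, 1] i) (v i) := by
  have h1 : P.HasValue 1 1 := by simpa using P.hasValue_algebraMap 1
  rcases P.exists_hasValue_additivePoly hq b h with ⟨c, d, hc, hd⟩ | ⟨hx0, hx, hz⟩
  · refine ⟨1, ![c, d, 1], fun h => one_ne_zero (congrFun h 2), Or.inl one_ne_zero, fun i => ?_⟩
    rw [one_mul]
    fin_cases i
    · exact hc
    · exact hd
    · exact h1
  · refine ⟨x⁻¹, ![1, 0, 0], fun h => one_ne_zero (congrFun h 0), Or.inr rfl, fun i => ?_⟩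
    fin_cases i
    · change P.HasValue (x⁻¹ * x) 1
      rwa [inv_mul_cancel₀ hx0]
    · exact hz
    · change P.HasValue (x⁻¹ * 1) 0
      rwa [mul_one]

/-- The function field of `y ^ (q ^ r + 1) = x ^ q + x` is generated by `x` and
`z = additivePoly q r b y`, and it is Galois over `K(x)` and over `K(x + z)`. -/
theorem isGalois_and_mem_of_additivePoly_mem [IsAlgClosed K] {L : Type*} [Field L] [Algebra K L]
    (p : ℕ) [Fact p.Prime] [CharP K p] {n q r : ℕ} (hn : 0 < n) (hqp : q = p ^ n) (hr : 0 < r)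
    {a b : K} (hb0 : b ≠ 0) (hb : b ^ q ^ (2 * r) = (-1) ^ (r - 1) * b)
    (ha : a ^ q + a = b ^ (q ^ r + 1)) {x y : L} (hxy : y ^ (q ^ r + 1) = x ^ q + x)
    (hyK : y ∉ (algebraMap K L).range)
    (htop : ∀ M : IntermediateField K L, x ∈ M → y ∈ M → M = ⊤) :
    IsGalois K⟮x⟯ L ∧ IsGalois K⟮x + additivePoly q r b y⟯ L ∧
      ∀ M : IntermediateField K L, x ∈ M → additivePoly q r b y ∈ M → y ∈ M := by
  have hN : ((q ^ r + 1 : ℕ) : K) ≠ 0 := by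
    have : (q : K) = 0 := by simp [hqp, hn.ne']
    simp [this, hr.ne']
  have hxy' := add_pow_eq_of_pow_eq p hqp hr hb ha hxy
  set z := additivePoly q r b y with hz
  have hy0 : y ≠ 0 := fun h => hyK (h ▸ zero_mem _)
  have hyb : y + algebraMap K _ b ≠ 0 := fun h => hyK
    ⟨-b, by rw [map_neg]; exact (eq_neg_of_add_eq_zero_left h).symm⟩
  have hmx : y ^ (q ^ r + 1) ∈ K⟮x⟯ := by
    rw [hxy]
    exact add_mem (pow_mem (mem_adjoin_simple_self K x) _) (mem_adjoin_simple_self K x)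
  have htopxy : K⟮x, y⟯ = ⊤ := htop _ (subset_adjoin _ _ (by simp)) (subset_adjoin _ _ (by simp))
  refine ⟨isGalois_adjoin_simple_of_pow_mem hN hy0 hmx htopxy,
    isGalois_adjoin_simple_of_pow_mem hN hyb ?_ ?_, fun M hxM hzM => ?_⟩
  · have : x + z + algebraMap K _ a ∈ K⟮x + z⟯ :=
      add_mem (mem_adjoin_simple_self K _) (IntermediateField.algebraMap_mem _ a)
    rw [hxy']
    exact add_mem (pow_mem this _) this
  -- Subtracting `b` recovers `y`, hence `z`, and then `x` from `x + z`.
  · have h1 : x + z ∈ K⟮x + z, y + algebraMap K _ b⟯ := subset_adjoin _ _ (by simp)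
    have h2 : y + algebraMap K _ b ∈ K⟮x + z, y + algebraMap K _ b⟯ :=
      subset_adjoin _ _ (by simp)
    have h3 : y ∈ K⟮x + z, y + algebraMap K _ b⟯ := by
      have := sub_mem h2 (IntermediateField.algebraMap_mem _ b)
      rwa [add_sub_cancel_right] at this
    refine htop _ ?_ h3
    have := sub_mem h1 (additivePoly_mem q r b h3)
    rwa [← hz, add_sub_cancel_right] at this
  · refine mem_of_pow_mem_of_add_pow_mem hN hyK hmx htopxy hb0 M hxM ?_
    have : x + z + algebraMap K _ a ∈ M := add_mem (add_mem hxM hzM) (M.algebraMap_mem a)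
    rw [hxy']
    exact add_mem (pow_mem this _) this

end

/-! ### The function field of the given curve -/

section

variable {K : Type*} [Field K]

theorem middleEquiv_curveGPoly (q r : ℕ) :
    middleEquiv K (curveGPoly K q r) = X ^ (q ^ r + 1) -
      C (MvPolynomial.X 0 ^ q * MvPolynomial.X 1 ^ (q ^ r + 1 - q) +
        MvPolynomial.X 0 * MvPolynomial.X 1 ^ (q ^ r)) := by
  simp only [curveGPoly, map_sub, map_add, map_mul, map_pow, middleEquiv_X_zero,
    middleEquiv_X_one, middleEquiv_X_two]

theorem curveG_cls_middleEquiv_symm_C_ne_zero {q r : ℕ} (hq : 1 < q) (hr : 2 ≤ r)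
    {a : MvPolynomial (Fin 2) K} (ha : a ≠ 0) :
    (curveG K q r hq hr).cls ((middleEquiv K).symm (C a)) ≠ 0 := by
  intro h
  rw [PlaneCurve.cls_eq_zero_iff] at h
  obtain ⟨T, hT⟩ := h
  have h2 := congrArg (middleEquiv K) hT
  rw [AlgEquiv.apply_symm_apply, map_mul] at h2
  change C a = middleEquiv K (curveGPoly K q r) * _ at h2
  rw [middleEquiv_curveGPoly] at h2
  have h3 := eq_zero_of_dvd_of_natDegree_lt ⟨_, h2⟩ (by
    rw [natDegree_C, natDegree_X_pow_sub_C]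
    exact Nat.succ_pos _)
  exact ha (C_eq_zero.1 h3)

theorem curveG_cls_X_two_ne_zero {q r : ℕ} (hq : 1 < q) (hr : 2 ≤ r) :
    (curveG K q r hq hr).cls (MvPolynomial.X 2) ≠ 0 := by
  have := curveG_cls_middleEquiv_symm_C_ne_zero (K := K) hq hr
    (MvPolynomial.X_ne_zero (R := K) (1 : Fin 2))
  rwa [← middleEquiv_X_two, AlgEquiv.symm_apply_apply] at this

/-- The affine coordinate functions `x`, `y`, `1` on the curve. -/
noncomputable def curveGCoord (K : Type*) [Field K] {q r : ℕ} (hq : 1 < q) (hr : 2 ≤ r)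
    (i : Fin 3) : (curveG K q r hq hr).functionField :=
  ⟨(curveG K q r hq hr).cls (MvPolynomial.X i) / (curveG K q r hq hr).cls (MvPolynomial.X 2),
    (curveG K q r hq hr).ratio_mem_functionField (MvPolynomial.isHomogeneous_X _ _)
      (MvPolynomial.isHomogeneous_X _ _)⟩

theorem curveGCoord_two {q r : ℕ} (hq : 1 < q) (hr : 2 ≤ r) : curveGCoord K hq hr 2 = 1 :=
  Subtype.ext (div_self (curveG_cls_X_two_ne_zero hq hr))

theorem curveGCoord_equation {q r : ℕ} (hq : 1 < q) (hr : 2 ≤ r) :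
    curveGCoord K hq hr 1 ^ (q ^ r + 1) = curveGCoord K hq hr 0 ^ q + curveGCoord K hq hr 0 := by
  have h : MvPolynomial.aeval (curveGCoord K hq hr) (curveGPoly K q r) = 0 := by
    refine (PlaneCurve.aeval_eq_zero_iff_of_cone (D := curveG K q r hq hr)
      (curveG_cls_X_two_ne_zero hq hr) (fun G => ?_) (q ^ r + 1) _
      (curveGPoly_isHomogeneous K q r hr)).2 dvd_rfl
    have hfun : (fun i => (curveG K q r hq hr).cls (MvPolynomial.X 2) *
        (curveGCoord K hq hr i : (curveG K q r hq hr).ConeField)) =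
        fun i => (curveG K q r hq hr).cls (MvPolynomial.X i) :=
      funext fun i => mul_div_cancel₀ _ (curveG_cls_X_two_ne_zero hq hr)
    rw [hfun, PlaneCurve.aeval_cls_X, PlaneCurve.cls_eq_zero_iff]
  simp only [curveGPoly, map_sub, map_add, map_mul, map_pow, MvPolynomial.aeval_X,
    curveGCoord_two, one_pow, mul_one] at h
  exact sub_eq_zero.1 h

theorem curveGCoord_zero_notMem {q r : ℕ} (hq : 1 < q) (hr : 2 ≤ r) :
    curveGCoord K hq hr 0 ∉ (algebraMap K (curveG K q r hq hr).functionField).range := by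
  rintro ⟨c, hc⟩
  have hne :
      (MvPolynomial.X 0 - MvPolynomial.C c * MvPolynomial.X 1 : MvPolynomial (Fin 2) K) ≠ 0 := by
    intro h
    have := congrArg (MvPolynomial.eval ![1, 0]) h
    simp at this
  apply curveG_cls_middleEquiv_symm_C_ne_zero hq hr hne
  have h1 : (middleEquiv K).symm
      (C (MvPolynomial.X 0 - MvPolynomial.C c * MvPolynomial.X 1 : MvPolynomial (Fin 2) K)) =
      MvPolynomial.X 0 - MvPolynomial.C c * MvPolynomial.X 2 := by
    have hc : middleEquiv K (MvPolynomial.C c) = C (MvPolynomial.C c) := (middleEquiv K).commutes c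
    rw [AlgEquiv.symm_apply_eq, map_sub (middleEquiv K), map_mul (middleEquiv K),
      middleEquiv_X_zero, middleEquiv_X_two, hc, map_sub, map_mul]
  have h2 := congrArg Subtype.val hc
  change algebraMap K _ c = _ / _ at h2
  rw [h1, ← PlaneCurve.aeval_cls_X, map_sub, map_mul, MvPolynomial.aeval_C, MvPolynomial.aeval_X,
    MvPolynomial.aeval_X, h2, div_mul_cancel₀ _ (curveG_cls_X_two_ne_zero hq hr), sub_self]

/-- If `y` were constant, the equation would make `x` algebraic over `K`, hence constant. -/
theorem curveGCoord_one_notMem [IsAlgClosed K] {q r : ℕ} (hq : 1 < q) (hr : 2 ≤ r) :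
    curveGCoord K hq hr 1 ∉ (algebraMap K (curveG K q r hq hr).functionField).range := by
  rintro ⟨d, hd⟩
  have hp : (X ^ q + X - C (d ^ (q ^ r + 1)) : K[X]).Monic := by
    rw [add_sub_assoc]
    refine monic_X_pow_add ?_
    rw [degree_X_sub_C]
    exact_mod_cast hq
  have halg : IsAlgebraic K (curveGCoord K hq hr 0) := ⟨_, hp.ne_zero, by
    simp [hd, curveGCoord_equation hq hr]⟩
  refine curveGCoord_zero_notMem (K := K) hq hr ?_
  exact minpoly.mem_range_of_degree_eq_one K (curveGCoord K hq hr 0)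
    (IsAlgClosed.degree_eq_one_of_irreducible K (minpoly.irreducible halg.isIntegral))

theorem eq_top_of_curveGCoord_mem {q r : ℕ} (hq : 1 < q) (hr : 2 ≤ r)
    {M : IntermediateField K (curveG K q r hq hr).functionField}
    (h0 : curveGCoord K hq hr 0 ∈ M) (h1 : curveGCoord K hq hr 1 ∈ M) : M = ⊤ := by
  refine PlaneCurve.functionField_eq_top_of_mem (curveG_cls_X_two_ne_zero hq hr)
    (g := curveGCoord K hq hr) (fun i => rfl) M fun i => ?_
  fin_cases i
  · exact h0
  · exact h1
  · change curveGCoord K hq hr 2 ∈ M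
    rw [curveGCoord_two]
    exact one_mem M

theorem coe_additivePoly {L : Type*} [Field L] [Algebra K L] (F : IntermediateField K L) (q r : ℕ)
    (b : K) (t : F) : ((additivePoly q r b t : F) : L) = additivePoly q r b (t : L) := by
  change F.val _ = _
  rw [additivePoly, map_sum]
  rfl

end

/-! ### The morphism `(x : z : 1)` and its two Galois points -/

theorem theorem2 (K : Type*) [Field K] [IsAlgClosed K] (p : ℕ) [Fact p.Prime] [CharP K p]
    (n : ℕ) (hn : 0 < n) (q : ℕ) (hqp : q = p ^ n) (hq : 1 < q) (r : ℕ) (hr : 2 ≤ r) :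
    ∃ (ξ : (curveG K q r hq hr).PlaneMorphism) (D : PlaneCurve K),
      ξ.IsBirationalOnto D ∧ D.degree = q ^ r + 1 ∧
      ∃ P₁ P₂ : ℙ K (Fin 3 → K),
        P₁ ≠ P₂ ∧ D.IsOuterGaloisPoint P₁ ∧ D.IsOuterGaloisPoint P₂ := by
  -- The sign `(-1) ^ (r - 1)` is the one for which the telescoping sum ends in `b y ^ (q ^ r)`; `a`
  -- then absorbs the constant term `b ^ (q ^ r + 1)`.
  obtain ⟨b, hb0, hb⟩ := exists_pow_eq_neg_one_pow_mul K (q ^ (2 * r)) (r - 1)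
    (Nat.one_lt_pow (by omega) hq)
  obtain ⟨a, ha⟩ := exists_pow_add_self_eq hq (b ^ (q ^ r + 1))
  set C₀ := curveG K q r hq hr with hC₀
  set x : C₀.functionField := curveGCoord K hq hr 0 with hx
  set y : C₀.functionField := curveGCoord K hq hr 1 with hy
  set z : C₀.functionField := additivePoly q r b y with hz
  have hxK : x ∉ (algebraMap K C₀.functionField).range := curveGCoord_zero_notMem hq hr
  have hyK : y ∉ (algebraMap K C₀.functionField).range := curveGCoord_one_notMem hq hr
  have hxy : y ^ (q ^ r + 1) = x ^ q + x := curveGCoord_equation hq hr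
  have htop : ∀ {M : IntermediateField K C₀.functionField}, x ∈ M → y ∈ M → M = ⊤ :=
    eq_top_of_curveGCoord_mem hq hr
  have hx0 : x ≠ 0 := fun h => hxK (h ▸ zero_mem _)
  obtain ⟨hgal₁, hgal₂, hyM⟩ := isGalois_and_mem_of_additivePoly_mem p hn hqp (by omega) hb0 hb ha
    hxy hyK fun M => htop
  rw [← hz] at hgal₂ hyM
  set f : Fin 3 → C₀.functionField := ![x, z, 1] with hf
  set w : C₀.ConeField := C₀.cls (MvPolynomial.X 2) with hw
  have hw0 : w ≠ 0 := curveG_cls_X_two_ne_zero hq hr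
  have hwx : w * (x : C₀.ConeField) = C₀.cls (MvPolynomial.X 0) := mul_div_cancel₀ _ hw0
  have hwy : w * (y : C₀.ConeField) = C₀.cls (MvPolynomial.X 1) := mul_div_cancel₀ _ hw0
  have hmem : ∀ (M : IntermediateField K C₀.ConeField), w ∈ M → ∀ t : C₀.ConeField,
      w * t ∈ M → t ∈ M := fun M hwM t ht => by
    have := mul_mem (inv_mem hwM) ht
    rwa [inv_mul_cancel_left₀ hw0] at this
  obtain ⟨D, hDdeg, hker⟩ := exists_planeCurve_of_coord C₀
    (by
      change (middleEquiv K (curveGPoly K q r)).Monic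
      rw [middleEquiv_curveGPoly]
      exact monic_X_pow_sub_C _ (Nat.succ_ne_zero _)) f
    (u := fun i => w * (f i : C₀.ConeField)) rfl hwx (mul_one _)
    (by
      change RingHom.IsIntegralElem _ (w * (z : C₀.ConeField))
      rw [← hwx, hz, coe_additivePoly]
      exact isIntegralElem_mul_additivePoly hq b (by exact_mod_cast congrArg Subtype.val hxy))
    (by
      intro M hM0 hM2
      change _ ↔ w * (z : C₀.ConeField) ∈ M
      rw [← hwx] at hM0
      rw [← hwy]
      constructor
      · intro h
        refine mul_mem hM2 ?_
        rw [hz, coe_additivePoly]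
        exact additivePoly_mem q r b (hmem M hM2 _ h)
      · intro h
        exact mul_mem hM2 (hyM (M.comap C₀.functionField.val) (hmem M hM2 _ hM0)
          (hmem M hM2 _ h)))
  have hval : ∀ P : C₀.SmoothModel, ∃ (g : C₀.functionField) (v : Fin 3 → K), v ≠ 0 ∧
      (v 2 ≠ 0 ∨ v 1 = 0) ∧ ∀ i, P.HasValue (g * f i) (v i) :=
    fun P => P.exists_hasValue_coord hq b hxy
  let ξ : C₀.PlaneMorphism := PlaneCurve.PlaneMorphism.ofCoord f
    (fun h => one_ne_zero (congrFun h 2)) fun P => by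
      obtain ⟨g, v, hv, -, h⟩ := hval P
      exact ⟨g, v, hv, h⟩
  have hrange : Set.range ξ.toFun = D.points := by
    -- If all coordinates were constant multiples of one of them, `x / 1` would be constant.
    refine ξ.range_eq_points D (PlaneCurve.aeval_eq_zero_iff_of_cone hw0 hker) fun i hi => ?_
    by_contra! hne
    obtain ⟨c₀, hc₀⟩ := hne 0
    obtain ⟨c₂, hc₂⟩ := hne 2
    change x = _ at hc₀
    change 1 = _ at hc₂
    have hc2 : c₂ ≠ 0 := by
      rintro rfl
      simp at hc₂
    refine hxK ⟨c₀ / c₂, ?_⟩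
    rw [map_div₀, hc₀, div_eq_iff ((_root_.map_ne_zero _).2 hc2), mul_assoc,
      mul_comm (ξ.coord i), ← hc₂, mul_one]
  have houter : ∀ (v : Fin 3 → K) (hv : v ≠ 0), v 2 = 0 → v 1 ≠ 0 →
      Projectivization.mk K v hv ∉ D.points := by
    intro v hv h2 h1 hmem
    rw [← hrange] at hmem
    obtain ⟨P, hP⟩ := hmem
    obtain ⟨g, v', hv', hor, h⟩ := hval P
    rw [ξ.toFun_eq P g v' hv' h, Projectivization.mk_eq_mk_iff] at hP
    obtain ⟨s, rfl⟩ := hP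
    rcases hor with h' | h'
    · apply h'
      change (s : K) * v 2 = 0
      rw [h2, mul_zero]
    · change (s : K) * v 1 = 0 at h'
      exact (mul_ne_zero s.ne_zero h1) h'
  obtain ⟨e, he⟩ := PlaneCurve.exists_isPullback hw0 hker fun M hM => by
    have h0 : x ∈ M := by simpa [hf] using hM 0 2
    have h1 : z ∈ M := by simpa [hf] using hM 1 2
    exact htop h0 (hyM M h0 h1)
  have hD2 : D.cls (MvPolynomial.X 2) ≠ 0 := by
    rw [Ne, D.cls_eq_zero_iff, ← PlaneCurve.aeval_eq_zero_iff_of_cone hw0 hker 1 _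
      (MvPolynomial.isHomogeneous_X K 2), MvPolynomial.aeval_X]
    exact one_ne_zero
  have hlin : ∀ (ℓ : MvPolynomial (Fin 3) K), ℓ.IsHomogeneous 1 → ∃ c : Fin 3 → K,
      (∀ v, MvPolynomial.eval v ℓ = c 0 * v 0 + c 1 * v 1 + c 2 * v 2) ∧
      MvPolynomial.aeval f ℓ = algebraMap K _ (c 0) * x + algebraMap K _ (c 1) * z +
        algebraMap K _ (c 2) := by
    intro ℓ hℓ
    obtain ⟨c, rfl⟩ := PlaneCurve.exists_linear_of_isHomogeneous_one hℓ
    refine ⟨c, fun v => ?_, ?_⟩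
    · simp [Fin.sum_univ_three]
    · simp [Fin.sum_univ_three, hf]
  -- Forms vanishing at `(0 : 1 : 0)` are spanned by `X` and `Z`, those vanishing at `(1 : -1 : 0)`
  -- by `X + Y` and `Z`; dividing by `Z` gives the projections `x` and `x + z`.
  have hv₁ : (![0, 1, 0] : Fin 3 → K) ≠ 0 := fun h => one_ne_zero (congrFun h 1)
  have hv₂ : (![1, -1, 0] : Fin 3 → K) ≠ 0 := fun h => one_ne_zero (congrFun h 0)
  have hXh := MvPolynomial.isHomogeneous_X (σ := Fin 3) K
  refine ⟨ξ, D, ⟨hrange, e, he⟩, ?_, Projectivization.mk K _ hv₁, Projectivization.mk K _ hv₂,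
    ?_, ⟨houter _ _ rfl one_ne_zero, ?_⟩, ⟨houter _ _ rfl (neg_ne_zero.2 one_ne_zero), ?_⟩⟩
  · rw [hDdeg]
    exact (curveGPoly_isHomogeneous K q r hr).totalDegree
      (curveGPoly_irreducible K q r hq hr).ne_zero
  · rw [Ne, Projectivization.mk_eq_mk_iff]
    rintro ⟨s, hs⟩
    have : (s : K) * 1 = 0 := congrFun hs 0
    exact s.ne_zero ((mul_one _).symm.trans this)
  · refine PlaneCurve.isGaloisPoint_of_map_eq e (PlaneCurve.map_projectionField he _ hv₁ x ?_
      (hXh 0) (hXh 2) (by simp) (by simp) hD2 (by simp [hf])) hgal₁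
    intro ℓ hℓ h0
    obtain ⟨c, hc, hc'⟩ := hlin ℓ hℓ
    rw [hc] at h0
    have hc1 : c 1 = 0 := by simpa using h0
    rw [hc', hc1, map_zero, zero_mul, add_zero]
    exact add_mem (mul_mem (IntermediateField.algebraMap_mem _ _) (mem_adjoin_simple_self K x))
      (IntermediateField.algebraMap_mem _ _)
  · refine PlaneCurve.isGaloisPoint_of_map_eq e (PlaneCurve.map_projectionField he _ hv₂ (x + z) ?_
      ((hXh 0).add (hXh 1)) (hXh 2) (by simp) (by simp) hD2 (by simp [hf])) hgal₂
    intro ℓ hℓ h0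
    obtain ⟨c, hc, hc'⟩ := hlin ℓ hℓ
    rw [hc] at h0
    have hc1 : c 0 = c 1 := by
      have : c 0 + -c 1 = 0 := by simpa using h0
      rwa [← sub_eq_add_neg, sub_eq_zero] at this
    rw [hc', hc1, ← mul_add]
    exact add_mem (mul_mem (IntermediateField.algebraMap_mem _ _) (mem_adjoin_simple_self K _))
      (IntermediateField.algebraMap_mem _ _)
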